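/- **Proposition 3.4** (An $A_{r-1}$ nonterminating very-well-poised $_8\phi_7$ summation). For $q\in\mathbb C$ with $|q|<1$ write $$(x;q)_\infty=\prod_{j=0}^{\infty}(1-xq^j),\qquad (x;q)_k=\prod_{j=0}^{k-1}(1-xq^j)=\frac{(x;q)_\infty}{(xq^k;q)_\infty}\quad(k\ge 0),$$ (the last quotient where its denominator is nonzero), and $(x_1,\dots,x_m;q)_\infty=(x_1;q)_\infty\cdots(x_m;q)_\infty$. Let $r\ge 1$, let $q,a,c,f,g,e_1,\dots,e_r,z_1,\dots,z_r$ be complex numbers, put $E=e_1\cdots e_r$ and $|\mathbf k|=k_1+\cdots+k_r$, and suppose that $|q|<1$, that $|a/Efg|<1$, and that none of the denominators in the identity below vanishes (in particular $q,a,c,f,g$ and all $e_i,z_i$ are nonzero and the $z_i$ are pairwise distinct). Then the following $r$-fold series converges absolutely, and $$\begin{aligned} &\sum_{k_1,\dots,k_r=0}^{\infty}\Bigg(\prod_{1\le i<j\le r}\frac{z_iq^{k_i}-z_jq^{k_j}}{z_i-z_j}\prod_{i=1}^r\frac{1-az_iq^{k_i+|\mathbf k|}}{1-az_i}\prod_{i,j=1}^r\frac{(e_jz_i/z_j;q)_{k_i}}{(qz_i/z_j;q)_{k_i}}\\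 &\qquad\times\prod_{i=1}^r\frac{(az_i;q)_{|\mathbf k|}\,(fz_i;q)_{k_i}}{(az_iq/e_i;q)_{|\mathbf k|}\,(az_iq/g;q)_{k_i}}\cdot\frac{(g;q)_{|\mathbf k|}}{(aq/f;q)_{|\mathbf k|}}\cdot\frac{1-cq^{|\mathbf k|-1}}{1-c/q}\prod_{i=1}^r\frac{1-az_iq^{k_i+1}/c}{1-az_iq/c}\cdot\left(\frac{a}{Efg}\right)^{|\mathbf k|}\Bigg)\\ &=\left(1-\frac{(1-1/g)(1-cf/aq)}{(1-c/gq)(1-Ef/a)}\prod_{i=1}^r\frac{1-ce_i/az_iq}{1-c/az_iq}\right)\frac{1-c/gq}{1-c/q}\\ &\qquad\times\frac{(a/Ef,\,aq/fg;q)_\infty}{(a/Efg,\,aq/f;q)_\infty}\prod_{i=1}^r\frac{(az_iq,\,az_iq/e_ig;q)_\infty}{(az_iq/e_i,\,az_iq/g;q)_\infty}. \end{aligned}$$ Here slashes in a monomial divide by everything to their right: $a/Efg=a/(Efg)$, $cf/aq=cf/(aq)$, $ce_i/az_iq=ce_i/(az_iq)$, and so on. -/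

import Mathlib

/-- The infinite `q`-shifted factorial `(a; q)_∞ = ∏_{j ≥ 0} (1 - a q ^ j)`; the product converges
unconditionally when `‖q‖ < 1`, see `qPochInf_multipliable`. -/
noncomputable def qPochInf (a q : ℂ) : ℂ := ∏' j : ℕ, (1 - a * q ^ j)

/-- The `q`-shifted factorial `(a; q)_k = (1 - a) (1 - a q) ⋯ (1 - a q ^ (k - 1))` for `k ≥ 0`.
By `qPoch_eq_div` it is `(a; q)_∞ / (a q ^ k; q)_∞` wherever that quotient makes sense; the finite
product is its continuous extension to all `a`, as is needed for terminating series. -/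
noncomputable def qPoch (a q : ℂ) (k : ℕ) : ℂ := ∏ j ∈ Finset.range k, (1 - a * q ^ j)

theorem qPochInf_multipliable (a q : ℂ) (hq : ‖q‖ < 1) :
    Multipliable (fun j : ℕ => 1 - a * q ^ j) := by
  have h : Summable (fun j : ℕ => ‖-(a * q ^ j)‖) := by
    simpa [norm_mul, norm_pow] using
      (summable_geometric_of_lt_one (norm_nonneg q) hq).mul_left ‖a‖
  simpa [sub_eq_add_neg] using multipliable_one_add_of_summable h

theorem qPoch_mul_qPochInf (a q : ℂ) (hq : ‖q‖ < 1) (k : ℕ) :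
    qPoch a q k * qPochInf (a * q ^ k) q = qPochInf a q := by
  have h := qPochInf_multipliable (a * q ^ k) q hq
  have h2 : Multipliable (fun j : ℕ => 1 - a * q ^ (j + k)) := by
    refine h.congr fun j => ?_
    ring
  have h3 := Multipliable.prod_mul_tprod_nat_mul' (f := fun j : ℕ => 1 - a * q ^ j) h2
  rw [qPoch, qPochInf, qPochInf, ← h3]
  congr 1
  refine tprod_congr fun j => ?_
  ring

theorem qPoch_eq_div (a q : ℂ) (hq : ‖q‖ < 1) (k : ℕ) (h : qPochInf (a * q ^ k) q ≠ 0) :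
    qPoch a q k = qPochInf a q / qPochInf (a * q ^ k) q := by
  rw [eq_div_iff h, qPoch_mul_qPochInf a q hq k]

/-!
The series terminates if `g = q ^ (-N)`, and this case implies the general one. As functions of
`u = 1 / g`, after multiplication by `(a u / E f; q)_∞ ∏ i, (a z i q u; q)_∞`, both sides of the
identity are analytic on a disk about `0` (`differentiable_entireTerm` and
`exists_norm_entireTerm_le`), and the points `u = q ^ N` accumulate at `0`. So the identity theorem
applies (`hasSum_entireTerm`).

For `g = q ^ (-N)` the very-well-poised structure disappears if one more variable
`z₀ = q ^ (-N) / a` is added, with summation index `k 0 = N - |k|`. The factors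
`1 - a z i q ^ (k i + |k|)` are then part of the Vandermonde product in `r + 1` variables, the
factors that involve `c` combine to `∏ i, (1 - t z i q ^ k i)` over all `r + 1` variables, where
`t = a q / c`, and the sum becomes
`∑_{k 0 + ... + k r = N} Δ(z q^k) / Δ(z) ∏ i j, (a j z i; q)_{k i} / (q z i / z j; q)_{k i}`
`× ∏ i, (1 - t z i q ^ k i)` (`milneTerm_cons`). The translation needs `z₀` to differ from the `z i`
modulo powers of `q`; since this excludes only countably many `a`, continuity in `a` removes the
restriction (`sum_seriesCoeff`).

For `t = 0` this last sum is Milne's fundamental theorem, with value `(A; q)_N / (q; q)_N` where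
`A = ∏ i, a i z i`. For general `t` it is evaluated by induction on `N`
(`QGeneric.qPoch_mul_sum_milneTerm_mul_prod`): multiply each term by `1 - q ^ N`, written as a sum
over `l` of partial fractions whose `l`-th summand vanishes if `k l = 0`, shift `k l` by one, and
apply the partial fraction identity again, to the sum over `l` that has appeared.
-/

/-! ### Partial fractions and Vandermonde products -/

open Finset in
/-- Partial fractions in several variables. Up to sign and the factor `∏ j, x j`, this is Lagrange
interpolation of the polynomial `∏ j, (t - a j) - ∏ j, (t - (x j)⁻¹)`, of degree less than the
number of nodes, at the nodes `t = (x l)⁻¹`. -/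
theorem sum_prod_div_mul_prod_erase {ι : Type*} [Fintype ι] [DecidableEq ι] (x a : ι → ℂ) (t : ℂ)
    (hx : Function.Injective x) (hx0 : ∀ i, x i ≠ 0) :
    ∑ l, (∏ j, (1 - a j * x l)) / (∏ j ∈ univ.erase l, (1 - x l / x j))
        * ∏ j ∈ univ.erase l, (1 - t * x j)
      = ∏ j, (1 - t * x j) - ∏ j, (a j * x j - t * x j) := by
  classical
  set v : ι → ℂ := fun i => (x i)⁻¹ with hv
  have hvi : Set.InjOn v (univ : Finset ι) := fun i _ j _ h => hx (inv_injective h)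
  set p : Polynomial ℂ := ∏ j, (Polynomial.X - Polynomial.C (a j))
    - ∏ j, (Polynomial.X - Polynomial.C (v j)) with hp
  have hdeg : p.degree < #(univ : Finset ι) := by
    have h1 : (∏ j, (Polynomial.X - Polynomial.C (a j))).degree
        = (#(univ : Finset ι) : WithBot ℕ) := by
      simp [Polynomial.degree_prod]
    have h2 : (∏ j, (Polynomial.X - Polynomial.C (v j))).degree
        = (#(univ : Finset ι) : WithBot ℕ) := by
      simp [Polynomial.degree_prod]
    rw [← h1]
    refine Polynomial.degree_sub_lt_left (h1.trans h2.symm) ?_ ?_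
    · exact (Polynomial.monic_prod_of_monic _ _ fun j _ => Polynomial.monic_X_sub_C _).ne_zero
    · rw [(Polynomial.monic_prod_of_monic _ _ fun j _ => Polynomial.monic_X_sub_C _).leadingCoeff,
        (Polynomial.monic_prod_of_monic _ _ fun j _ => Polynomial.monic_X_sub_C _).leadingCoeff]
  have hint := congrArg (Polynomial.eval t) (Lagrange.eq_interpolate hvi hdeg)
  have hpt : -(∏ j, (-x j)) * p.eval t = ∏ j, (1 - t * x j) - ∏ j, (a j * x j - t * x j) := by
    simp only [hp, Polynomial.eval_sub, Polynomial.eval_prod, Polynomial.eval_X, Polynomial.eval_C]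
    rw [neg_mul, mul_sub, ← prod_mul_distrib, ← prod_mul_distrib, neg_sub]
    congr 1
    · refine prod_congr rfl fun j _ => ?_
      have := hx0 j
      simp only [hv]
      field_simp
      ring
    · exact prod_congr rfl fun j _ => by ring
  rw [← hpt, hint, Lagrange.interpolate_apply, Polynomial.eval_finsetSum, mul_sum]
  refine sum_congr rfl fun l _ => ?_
  have hpl : p.eval (v l) = ∏ j, ((x l)⁻¹ * (1 - a j * x l)) := by
    simp only [hp, Polynomial.eval_sub, Polynomial.eval_prod, Polynomial.eval_X, Polynomial.eval_C]
    rw [prod_eq_zero (i := l) (f := fun j => v l - v j) (mem_univ l) (sub_self _), sub_zero]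
    refine prod_congr rfl fun j _ => ?_
    have := hx0 l
    simp only [hv]
    field_simp
  rw [Polynomial.eval_mul, Polynomial.eval_C, hpl, Lagrange.basis, Polynomial.eval_prod,
    prod_mul_distrib]
  simp only [Lagrange.basisDivisor, Polynomial.eval_mul, Polynomial.eval_C, Polynomial.eval_sub,
    Polynomial.eval_X]
  have hsign : (∏ j, (-x j)) * ∏ _j : ι, (x l)⁻¹ = -∏ j ∈ univ.erase l, (-x j * (x l)⁻¹) := by
    rw [← prod_mul_distrib, ← mul_prod_erase univ _ (mem_univ l)]
    have := hx0 l
    field_simp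
  have hfac : (∏ j ∈ univ.erase l, (-x j * (x l)⁻¹))
        * ∏ j ∈ univ.erase l, ((v l - v j)⁻¹ * (t - v j))
      = (∏ j ∈ univ.erase l, (1 - t * x j)) / ∏ j ∈ univ.erase l, (1 - x l / x j) := by
    rw [← prod_mul_distrib, ← prod_div_distrib]
    refine prod_congr rfl fun j hj => ?_
    have hjl : x j - x l ≠ 0 := sub_ne_zero.2 (hx.ne (ne_of_mem_erase hj))
    have h1 := hx0 l
    have h2 := hx0 j
    have h3 : 1 - x l / x j = (x j - x l) / x j := by field_simp
    have h4 : v l - v j = (x j - x l) / (x l * x j) := by simp only [hv]; field_simp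
    rw [h3, h4]
    simp only [hv]
    field_simp
    ring
  calc _ = (∏ j, (1 - a j * x l)) * ((∏ j ∈ univ.erase l, (1 - t * x j))
        / ∏ j ∈ univ.erase l, (1 - x l / x j)) := by ring
    _ = -((∏ j, (-x j)) * ∏ _j : ι, (x l)⁻¹) * (∏ j, (1 - a j * x l))
        * ∏ j ∈ univ.erase l, ((v l - v j)⁻¹ * (t - v j)) := by rw [← hfac, hsign]; ring
    _ = _ := by ring

open Finset in
theorem sum_prod_div_prod_erase {ι : Type*} [Fintype ι] [DecidableEq ι] (x a : ι → ℂ)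
    (hx : Function.Injective x) (hx0 : ∀ i, x i ≠ 0) :
    ∑ l, (∏ j, (1 - a j * x l)) / (∏ j ∈ univ.erase l, (1 - x l / x j))
      = 1 - ∏ j, a j * x j := by
  simpa using sum_prod_div_mul_prod_erase x a 0 hx hx0

open Finset in
/-- A product over pairs `i < j`, with the pairs that contain `l` split off. -/
theorem prod_Ioi_eq_mul_prod_erase {m : ℕ} (h : Fin m → Fin m → ℂ) (l : Fin m) :
    ∏ i, ∏ j ∈ Ioi i, h i j
      = (∏ i ∈ univ.erase l, ∏ j ∈ univ.erase l, if i < j then h i j else 1)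
        * ∏ j ∈ univ.erase l, (if l < j then h l j else h j l) := by
  have h0 : ∀ i, ∏ j ∈ Ioi i, h i j = ∏ j, if i < j then h i j else 1 := fun i => by
    rw [← prod_filter]
    congr 1
    ext j
    simp
  simp only [h0]
  rw [← mul_prod_erase univ _ (mem_univ l)]
  have h1 : ∀ i, (∏ j, if i < j then h i j else 1)
      = (if i < l then h i l else 1) * ∏ j ∈ univ.erase l, if i < j then h i j else 1 :=
    fun i => (mul_prod_erase univ _ (mem_univ l)).symm
  rw [prod_congr rfl fun i _ => h1 i, prod_mul_distrib, h1 l, if_neg (lt_irrefl l), one_mul,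
    ← mul_assoc, ← prod_mul_distrib, mul_comm]
  congr 1
  refine prod_congr rfl fun j hj => ?_
  rcases lt_or_gt_of_ne (ne_of_mem_erase hj) with hl | hl
  · simp [hl, hl.not_gt]
  · simp [hl, hl.not_gt]

open Finset in
/-- The effect on a Vandermonde product of changing the `l`-th variable to `y`. -/
theorem prod_Ioi_sub_update {m : ℕ} (x : Fin m → ℂ) (l : Fin m) (y : ℂ) :
    (∏ i, ∏ j ∈ Ioi i, (Function.update x l y i - Function.update x l y j))
        * ∏ j ∈ univ.erase l, (x l - x j)
      = (∏ i, ∏ j ∈ Ioi i, (x i - x j)) * ∏ j ∈ univ.erase l, (y - x j) := by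
  rw [prod_Ioi_eq_mul_prod_erase _ l, prod_Ioi_eq_mul_prod_erase (fun i j => x i - x j) l,
    mul_assoc, mul_assoc]
  refine congrArg₂ (· * ·) ?_ ?_
  · refine prod_congr rfl fun i hi => ?_
    refine prod_congr rfl fun j hj => ?_
    rw [Function.update_of_ne (ne_of_mem_erase hi), Function.update_of_ne (ne_of_mem_erase hj)]
  · rw [← prod_mul_distrib, ← prod_mul_distrib]
    refine prod_congr rfl fun j hj => ?_
    rw [Function.update_of_ne (ne_of_mem_erase hj), Function.update_self]
    split_ifs <;> ring

/-! ### Milne's fundamental theorem with an additional linear factor -/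

theorem qPoch_zero (x q : ℂ) : qPoch x q 0 = 1 := by simp [qPoch]

theorem qPoch_succ (x q : ℂ) (n : ℕ) : qPoch x q (n + 1) = qPoch x q n * (1 - x * q ^ n) :=
  Finset.prod_range_succ _ _

theorem qPoch_succ_left (x q : ℂ) (n : ℕ) :
    qPoch x q (n + 1) = (1 - x) * qPoch (x * q) q n := by
  rw [qPoch, Finset.prod_range_succ', qPoch, pow_zero, mul_one, mul_comm]
  congr 1
  exact Finset.prod_congr rfl fun j _ => by ring

open Finset in
/-- The summand of Milne's `U(n)` sum: the Vandermonde quotient `Δ(z q^k) / Δ(z)` times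
`∏ i j, (a j * z i; q)_{k i} / (q * z i / z j; q)_{k i}`. The numerator parameters are taken
relative to the variables, so that the sum over `k 0 + ... = N` depends on the `a j` only through
`∏ i, a i * z i`. -/
noncomputable def milneTerm {m : ℕ} (q : ℂ) (z a : Fin m → ℂ) (k : Fin m → ℕ) : ℂ :=
  (∏ i, ∏ j ∈ Ioi i, (z i * q ^ k i - z j * q ^ k j) / (z i - z j))
    * ∏ i, ∏ j, qPoch (a j * z i) q (k i) / qPoch (q * z i / z j) q (k i)

/-- The variables `z i` are nonzero and pairwise distinct modulo powers of `q`, and `q` is neither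
zero nor a root of unity: all denominators of `milneTerm q z a k` are then nonzero. -/
structure QGeneric {m : ℕ} (q : ℂ) (z : Fin m → ℂ) : Prop where
  q_ne_zero : q ≠ 0
  ne_zero : ∀ i, z i ≠ 0
  ne : ∀ i j, i ≠ j → ∀ s t : ℕ, z i * q ^ s ≠ z j * q ^ t
  pow_ne_one : ∀ s : ℕ, q ^ (s + 1) ≠ 1

namespace QGeneric
variable {m : ℕ} {q : ℂ} {z : Fin m → ℂ}

theorem injective (h : QGeneric q z) (k : Fin m → ℕ) :
    Function.Injective fun i => z i * q ^ k i := fun i j hij => by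
  by_contra hne
  exact h.ne i j hne _ _ hij

theorem mul_pow_ne_zero (h : QGeneric q z) (i : Fin m) (s : ℕ) : z i * q ^ s ≠ 0 :=
  mul_ne_zero (h.ne_zero i) (pow_ne_zero _ h.q_ne_zero)

theorem one_sub_ne_zero (h : QGeneric q z) (i j : Fin m) (s : ℕ) :
    1 - q * z i / z j * q ^ s ≠ 0 := by
  have hj := h.ne_zero j
  intro h0
  have h1 : z i * q ^ (s + 1) = z j * q ^ 0 := by
    field_simp at h0
    rw [pow_succ]
    linear_combination -h0
  by_cases hij : i = j
  · subst hij
    exact h.pow_ne_one s (mul_left_cancel₀ hj (by simpa using h1))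
  · exact h.ne i j hij _ _ h1

open Finset in
/-- Raising `k l` by one exchanges the partial fraction weights with parameters `(z j)⁻¹` at
`k + Pi.single l 1` for those with parameters `a j` at `k`. -/
theorem milneTerm_add_single_mul (h : QGeneric q z) (a : Fin m → ℂ) (k : Fin m → ℕ) (l : Fin m) :
    milneTerm q z a (k + Pi.single l 1)
        * ((∏ j, (1 - (z j)⁻¹ * (z l * q ^ (k l + 1))))
          / ∏ j ∈ univ.erase l, (1 - z l * q ^ (k l + 1) / (z j * q ^ k j)))
      = milneTerm q z a k * ((∏ j, (1 - a j * (z l * q ^ k l)))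
          / ∏ j ∈ univ.erase l, (1 - z l * q ^ k l / (z j * q ^ k j))) := by
  have hx : (fun i => z i * q ^ (k + Pi.single l 1 : Fin m → ℕ) i)
      = Function.update (fun i => z i * q ^ k i) l (z l * q ^ (k l + 1)) := by
    funext i
    by_cases hi : i = l
    · subst hi; simp
    · simp [hi]
  have hD := prod_Ioi_sub_update (fun i => z i * q ^ k i) l (z l * q ^ (k l + 1))
  rw [← hx] at hD
  have hP : ∏ i, ∏ j, qPoch (a j * z i) q ((k + Pi.single l 1 : Fin m → ℕ) i)
        / qPoch (q * z i / z j) q ((k + Pi.single l 1 : Fin m → ℕ) i)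
      = (∏ i, ∏ j, qPoch (a j * z i) q (k i) / qPoch (q * z i / z j) q (k i))
        * ((∏ j, (1 - a j * (z l * q ^ k l))) / ∏ j, (1 - (z j)⁻¹ * (z l * q ^ (k l + 1)))) := by
    rw [← mul_prod_erase univ _ (mem_univ l), ← mul_prod_erase univ
      (fun i => ∏ j, qPoch (a j * z i) q (k i) / qPoch (q * z i / z j) q (k i)) (mem_univ l),
      mul_right_comm]
    congr 1
    · rw [← prod_div_distrib, ← prod_mul_distrib]
      refine prod_congr rfl fun j _ => ?_
      simp only [Pi.add_apply, Pi.single_eq_same, qPoch_succ]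
      rw [div_mul_div_comm]
      congr 2 <;> ring
    · refine prod_congr rfl fun i hi => ?_
      simp [ne_of_mem_erase hi]
  have h1 : ∏ j, (1 - (z j)⁻¹ * (z l * q ^ (k l + 1))) ≠ 0 :=
    prod_ne_zero_iff.2 fun j _ => by
      convert h.one_sub_ne_zero l j (k l) using 2
      ring
  have h2 : ∏ j ∈ univ.erase l, (z l * q ^ k l - z j * q ^ k j) ≠ 0 :=
    prod_ne_zero_iff.2 fun j hj => sub_ne_zero.2 (h.ne l j (ne_of_mem_erase hj).symm _ _)
  have h3 : ∏ j ∈ univ.erase l, (z l * q ^ (k l + 1) - z j * q ^ k j) ≠ 0 :=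
    prod_ne_zero_iff.2 fun j hj => sub_ne_zero.2 (h.ne l j (ne_of_mem_erase hj).symm _ _)
  have h4 : ∏ j ∈ univ.erase l, (-(z j * q ^ k j)) ≠ 0 :=
    prod_ne_zero_iff.2 fun j _ => neg_ne_zero.2 (h.mul_pow_ne_zero j _)
  have h5 : ∀ s, ∏ j ∈ univ.erase l, (1 - z l * q ^ s / (z j * q ^ k j))
      = (∏ j ∈ univ.erase l, (z l * q ^ s - z j * q ^ k j))
        / ∏ j ∈ univ.erase l, (-(z j * q ^ k j)) := fun s => by
    rw [← prod_div_distrib]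
    refine prod_congr rfl fun j _ => ?_
    rw [one_sub_div (h.mul_pow_ne_zero j (k j)), div_neg, ← neg_div, neg_sub]
  rw [milneTerm, milneTerm, hP, h5, h5]
  simp only [prod_div_distrib]
  rw [div_div_eq_mul_div, div_div_eq_mul_div]
  generalize (∏ i, ∏ j ∈ Ioi i, (z i * q ^ (k + Pi.single l 1 : Fin m → ℕ) i
      - z j * q ^ (k + Pi.single l 1 : Fin m → ℕ) j))
    = D' at hD ⊢
  generalize (∏ i, ∏ j ∈ Ioi i, (z i * q ^ k i - z j * q ^ k j)) = D at hD ⊢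
  generalize (∏ i, ∏ j ∈ Ioi i, (z i - z j)) = D0 at hD ⊢
  generalize ∏ j ∈ univ.erase l, (z l * q ^ k l - z j * q ^ k j) = p1 at hD h2 ⊢
  generalize ∏ j ∈ univ.erase l, (z l * q ^ (k l + 1) - z j * q ^ k j) = p2 at hD h3 ⊢
  generalize ∏ j ∈ univ.erase l, (-(z j * q ^ k j)) = p3 at h4 ⊢
  generalize ∏ j, (1 - (z j)⁻¹ * (z l * q ^ (k l + 1))) = p4 at h1 ⊢
  generalize ∏ j, (1 - a j * (z l * q ^ k l)) = p5
  generalize (∏ i, ∏ j, qPoch (a j * z i) q (k i)) / (∏ i, ∏ j, qPoch (q * z i / z j) q (k i)) = p6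
  have hD' : D' = D * p2 / p1 := by rw [eq_div_iff h2]; exact hD
  rw [hD']
  field_simp

open Finset in
/-- Recursion in `N` for sums of `milneTerm` against an arbitrary weight `φ`. The partial fraction
weights with parameters `(z j)⁻¹` sum to `1 - q ^ (N + 1)`; inserting them under the sum and
shifting the index in each summand lowers `N + 1` to `N`. -/
theorem one_sub_pow_mul_sum_milneTerm (h : QGeneric q z) (a : Fin m → ℂ) (N : ℕ)
    (φ : (Fin m → ℕ) → ℂ) :
    (1 - q ^ (N + 1)) * ∑ k ∈ piAntidiag univ (N + 1), milneTerm q z a k * φ k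
      = ∑ k ∈ piAntidiag univ N, milneTerm q z a k * ∑ l, (∏ j, (1 - a j * (z l * q ^ k l)))
          / (∏ j ∈ univ.erase l, (1 - z l * q ^ k l / (z j * q ^ k j)))
          * φ (k + Pi.single l 1) := by
  have hw : ∀ k ∈ piAntidiag (univ : Finset (Fin m)) (N + 1),
      ∑ l, (∏ j, (1 - (z j)⁻¹ * (z l * q ^ k l)))
        / (∏ j ∈ univ.erase l, (1 - z l * q ^ k l / (z j * q ^ k j))) = 1 - q ^ (N + 1) := by
    intro k hk
    rw [sum_prod_div_prod_erase (fun i => z i * q ^ k i) (fun j => (z j)⁻¹) (h.injective k)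
      fun i => h.mul_pow_ne_zero i _, ← (mem_piAntidiag.1 hk).1, ← prod_pow_eq_pow_sum]
    congr 1
    refine prod_congr rfl fun j _ => ?_
    have := h.ne_zero j
    field_simp
  calc _ = ∑ k ∈ piAntidiag univ (N + 1), ∑ l, milneTerm q z a k
        * ((∏ j, (1 - (z j)⁻¹ * (z l * q ^ k l)))
        / (∏ j ∈ univ.erase l, (1 - z l * q ^ k l / (z j * q ^ k j)))) * φ k := by
        rw [mul_sum]
        refine sum_congr rfl fun k hk => ?_
        rw [← sum_mul, ← mul_sum, hw k hk]
        ring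
    _ = ∑ l, ∑ k ∈ piAntidiag univ (N + 1), milneTerm q z a k
        * ((∏ j, (1 - (z j)⁻¹ * (z l * q ^ k l)))
        / (∏ j ∈ univ.erase l, (1 - z l * q ^ k l / (z j * q ^ k j)))) * φ k := sum_comm
    _ = ∑ l, ∑ k ∈ piAntidiag univ N, milneTerm q z a k * ((∏ j, (1 - a j * (z l * q ^ k l)))
          / (∏ j ∈ univ.erase l, (1 - z l * q ^ k l / (z j * q ^ k j)))
          * φ (k + Pi.single l 1)) := by
        refine sum_congr rfl fun l _ => (sum_of_injOn (fun k => k + Pi.single l 1) ?_ ?_ ?_ ?_).symm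
        · exact fun k _ k' _ hk => add_right_cancel hk
        · intro k hk
          have hk := (mem_piAntidiag.1 (mem_coe.1 hk)).1
          simp [mem_piAntidiag, sum_add_distrib, hk]
        · intro k hk hkn
          -- an index outside the image has `k l = 0`, where the factor `j = l` vanishes
          have hkl : k l = 0 := by
            by_contra hkl
            have hle : Pi.single l 1 ≤ k := by
              intro i
              by_cases hi : i = l
              · subst hi; simp; omega
              · simp [hi]
            refine hkn ⟨k - Pi.single l 1, ?_, tsub_add_cancel_of_le hle⟩
            · have hk := (mem_piAntidiag.1 hk).1
              have := congrArg (fun f : Fin m → ℕ => ∑ i, f i) (tsub_add_cancel_of_le hle)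
              simp only [Pi.add_apply, sum_add_distrib, hk] at this
              simp at this
              simpa [mem_piAntidiag] using this
          have h0 : ∏ j, (1 - (z j)⁻¹ * (z l * q ^ k l)) = 0 :=
            prod_eq_zero (mem_univ l) (by simp [hkl, h.ne_zero l])
          simp [h0]
        · intro k _
          have := h.milneTerm_add_single_mul a k l
          rw [← mul_assoc, ← this]
          congr 3
          · simp
          · refine prod_congr rfl fun j hj => ?_
            simp [ne_of_mem_erase hj]
    _ = _ := by
        rw [sum_comm]
        exact sum_congr rfl fun k _ => (mul_sum _ _ _).symm

theorem milneTerm_zero (h : QGeneric q z) (a : Fin m → ℂ) : milneTerm q z a 0 = 1 := by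
  have h1 : ∀ i, ∀ j ∈ Finset.Ioi i, z i - z j ≠ 0 := fun i j hj => by
    simpa [sub_ne_zero] using h.ne i j (Finset.mem_Ioi.1 hj).ne 0 0
  simp only [milneTerm, Pi.zero_apply, pow_zero, mul_one, qPoch_zero, div_one,
    Finset.prod_const_one]
  exact Finset.prod_eq_one fun i _ => Finset.prod_eq_one fun j hj => div_self (h1 i j hj)

open Finset in
/-- Milne's fundamental theorem: the sum of `milneTerm` over `k` of size `N` is
`(A; q)_N / (q; q)_N`, where `A = ∏ i, a i * z i`. -/
theorem qPoch_mul_sum_milneTerm (h : QGeneric q z) (a : Fin m → ℂ) (N : ℕ) :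
    qPoch q q N * ∑ k ∈ piAntidiag univ N, milneTerm q z a k = qPoch (∏ i, a i * z i) q N := by
  induction N with
  | zero => simp [qPoch_zero, h.milneTerm_zero]
  | succ N ih =>
    have h1 := h.one_sub_pow_mul_sum_milneTerm a N fun _ => 1
    simp only [mul_one] at h1
    rw [qPoch_succ, qPoch_succ, ← ih, mul_assoc, ← pow_succ', h1, mul_assoc, sum_mul]
    congr 1
    refine sum_congr rfl fun k hk => ?_
    rw [sum_prod_div_prod_erase (fun i => z i * q ^ k i) a (h.injective k)
      fun i => h.mul_pow_ne_zero i _, ← (mem_piAntidiag.1 hk).1, ← prod_pow_eq_pow_sum,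
      ← prod_mul_distrib]
    simp only [mul_assoc]

open Finset in
/-- The recursion for the weight `∏ i, (1 - t * z i * q ^ k i)`. The index shift multiplies the
weight by `(1 - t q x) / (1 - t x) = q + (1 - q) / (1 - t x)`, where `x = z l * q ^ k l`, which is
why both cases `t = 0` and `t` arbitrary of the partial fraction identity enter. -/
theorem one_sub_pow_mul_sum_milneTerm_mul_prod (h : QGeneric q z) (a : Fin m → ℂ) (t : ℂ)
    (N : ℕ) :
    (1 - q ^ (N + 1)) * ∑ k ∈ piAntidiag univ (N + 1),
        milneTerm q z a k * ∏ i, (1 - t * (z i * q ^ k i))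
      = (1 - (∏ i, a i * z i) * q ^ (N + 1)) * ∑ k ∈ piAntidiag univ N,
          milneTerm q z a k * ∏ i, (1 - t * (z i * q ^ k i))
        - (1 - q) * q ^ N * (∏ i, (a i * z i - t * z i))
          * ∑ k ∈ piAntidiag univ N, milneTerm q z a k := by
  rw [h.one_sub_pow_mul_sum_milneTerm, mul_sum, mul_sum, ← sum_sub_distrib]
  refine sum_congr rfl fun k hk => ?_
  have hx := h.injective k
  have hx0 := fun i => h.mul_pow_ne_zero i (k i)
  have hpow : ∏ i, q ^ k i = q ^ N := by rw [prod_pow_eq_pow_sum, (mem_piAntidiag.1 hk).1]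
  have e0 := sum_prod_div_prod_erase (fun i => z i * q ^ k i) a hx hx0
  have e1 := sum_prod_div_mul_prod_erase (fun i => z i * q ^ k i) a t hx hx0
  have hA : ∏ j, a j * (z j * q ^ k j) = (∏ i, a i * z i) * q ^ N := by
    rw [← hpow, ← prod_mul_distrib]
    exact prod_congr rfl fun j _ => by ring
  have hB : ∏ j, (a j * (z j * q ^ k j) - t * (z j * q ^ k j))
      = (∏ i, (a i * z i - t * z i)) * q ^ N := by
    rw [← hpow, ← prod_mul_distrib]
    exact prod_congr rfl fun j _ => by ring
  simp only [hA, hB] at e0 e1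
  have key : ∑ l, (∏ j, (1 - a j * (z l * q ^ k l)))
        / (∏ j ∈ univ.erase l, (1 - z l * q ^ k l / (z j * q ^ k j)))
        * ∏ i, (1 - t * (z i * q ^ (k + Pi.single l 1 : Fin m → ℕ) i))
      = q * (1 - (∏ i, a i * z i) * q ^ N) * ∏ i, (1 - t * (z i * q ^ k i))
        + (1 - q) * (∏ j, (1 - t * (z j * q ^ k j)) - (∏ i, (a i * z i - t * z i)) * q ^ N) := by
    rw [← e0, ← e1, mul_sum, mul_sum, sum_mul, ← sum_add_distrib]
    refine sum_congr rfl fun l _ => ?_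
    have h1 : ∏ i, (1 - t * (z i * q ^ (k + Pi.single l 1 : Fin m → ℕ) i))
        = (1 - t * (z l * q ^ k l) * q) * ∏ j ∈ univ.erase l, (1 - t * (z j * q ^ k j)) := by
      rw [← mul_prod_erase univ _ (mem_univ l)]
      congr 1
      · simp only [Pi.add_apply, Pi.single_eq_same]; ring
      · exact prod_congr rfl fun j hj => by simp [ne_of_mem_erase hj]
    rw [h1, ← mul_prod_erase univ (fun i => 1 - t * (z i * q ^ k i)) (mem_univ l)]
    ring
  rw [key]
  ring

open Finset in
/-- Milne's fundamental theorem with the additional numerator `∏ i, (1 - t * z i * q ^ k i)`: the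
value is a combination of `∏ i, (1 - t * z i)` and `∏ i, (a i * z i - t * z i)`. -/
theorem qPoch_mul_sum_milneTerm_mul_prod (h : QGeneric q z) (a : Fin m → ℂ) (t : ℂ) (N : ℕ) :
    qPoch q q (N + 1) * ∑ k ∈ piAntidiag univ (N + 1),
        milneTerm q z a k * ∏ i, (1 - t * (z i * q ^ k i))
      = qPoch ((∏ i, a i * z i) * q) q (N + 1) * ∏ i, (1 - t * z i)
        - (1 - q ^ (N + 1)) * qPoch ((∏ i, a i * z i) * q) q N * ∏ i, (a i * z i - t * z i) := by
  induction N with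
  | zero =>
    have h1 := h.one_sub_pow_mul_sum_milneTerm_mul_prod a t 0
    simp [h.milneTerm_zero] at h1
    simp [qPoch_succ, qPoch_zero, h1]
  | succ N ih =>
    have h1 := h.one_sub_pow_mul_sum_milneTerm_mul_prod a t (N + 1)
    have h2 := h.qPoch_mul_sum_milneTerm a (N + 1)
    rw [qPoch_succ_left (∏ i, a i * z i)] at h2
    rw [qPoch_succ q, mul_assoc, ← pow_succ', h1, mul_sub, mul_left_comm, ih,
      qPoch_succ _ q (N + 1), qPoch_succ _ q N, mul_left_comm (qPoch q q (N + 1)), h2]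
    ring

end QGeneric

/-! ### Finite `q`-shifted factorials -/

open Finset in
/-- Reversal of the order of the factors in `(y q^{-n-M}; q)_M`. -/
theorem qPoch_div_pow_mul_prod (q y : ℂ) (hq0 : q ≠ 0) (hy : y ≠ 0) (n M : ℕ) :
    qPoch (y / q ^ (n + M)) q M * ∏ j ∈ range M, q ^ (n + 1 + j)
      = (-y) ^ M * ∏ j ∈ range M, (1 - q / y * q ^ (n + j)) := by
  rw [qPoch, ← prod_range_reflect, ← prod_mul_distrib, ← card_range M, ← prod_const, card_range,
    ← prod_mul_distrib]
  refine prod_congr rfl fun j hj => ?_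
  obtain ⟨d, rfl⟩ : ∃ d, M = j + 1 + d := ⟨M - (j + 1), by have := mem_range.1 hj; omega⟩
  have h1 : j + 1 + d - 1 - j = d := by omega
  rw [h1]
  field_simp
  ring

theorem qPoch_add (x q : ℂ) (n M : ℕ) :
    qPoch x q (n + M) = qPoch x q n * ∏ j ∈ Finset.range M, (1 - x * q ^ (n + j)) :=
  Finset.prod_range_add _ _ _

open Finset in
theorem qPoch_mul_prod_pow_sub_pow (q : ℂ) (n M : ℕ) :
    qPoch q q M * ∏ j ∈ range n, (q ^ (n + M) - q ^ j)
      = (-1) ^ n * (∏ j ∈ range n, q ^ j) * qPoch q q (n + M) := by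
  rw [add_comm n M, qPoch_add, ← prod_range_reflect (fun j => 1 - q * q ^ (M + j)),
    mul_left_comm]
  congr 1
  rw [← card_range n, ← prod_const, card_range, ← prod_mul_distrib, ← prod_mul_distrib]
  refine prod_congr rfl fun j hj => ?_
  obtain ⟨d, rfl⟩ : ∃ d, n = j + 1 + d := ⟨n - (j + 1), by have := mem_range.1 hj; omega⟩
  have h1 : j + 1 + d - 1 - j = d := by omega
  rw [h1]
  ring

open Finset in
theorem prod_range_pow_split (q : ℂ) (n M : ℕ) :
    (∏ j ∈ range n, q ^ j) * q ^ n * ∏ j ∈ range M, q ^ (n + 1 + j)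
      = ∏ j ∈ range (n + M + 1), q ^ j := by
  rw [show n + M + 1 = n + 1 + M by ring, prod_range_add, prod_range_succ]

/-- The contribution of one variable `z` to the ratio of `milneTerm` with the additional variable
`(q ^ (n + M) * a)⁻¹` to `milneTerm` without it; `s` and `M` are the summation indices of `z` and of
the additional variable. -/
theorem milne_column (q a e z : ℂ) (hq0 : q ≠ 0) (ha : a ≠ 0) (he : e ≠ 0) (hz : z ≠ 0)
    (haz : ∀ s, 1 - a * z * q ^ s ≠ 0) (s n M : ℕ)
    (haze : qPoch (a * z * q / e) q n ≠ 0) :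
    ((q ^ (n + M) * a)⁻¹ * q ^ M - z * q ^ s) / ((q ^ (n + M) * a)⁻¹ - z)
        * (qPoch (e / z * (q ^ (n + M) * a)⁻¹) q M / qPoch (q * (q ^ (n + M) * a)⁻¹ / z) q M)
      = e ^ M * ((1 - a * z * q ^ (s + n)) / (1 - a * z * q ^ (n + M)))
        * (qPoch (a * z * q / e) q (n + M) / qPoch (a * z * q / e) q n)
        * (qPoch (a * z) q n / qPoch (a * z) q (n + M)) := by
  have e1 : ((q ^ (n + M) * a)⁻¹ * q ^ M - z * q ^ s) / ((q ^ (n + M) * a)⁻¹ - z)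
      = q ^ M * ((1 - a * z * q ^ (s + n)) / (1 - a * z * q ^ (n + M))) := by
    have h1 := haz (n + M)
    have h2 : (q ^ (n + M) * a)⁻¹ - z = (1 - a * z * q ^ (n + M)) / (q ^ (n + M) * a) := by
      field_simp
    have h3 : (q ^ (n + M) * a)⁻¹ * q ^ M - z * q ^ s
        = q ^ M * (1 - a * z * q ^ (s + n)) / (q ^ (n + M) * a) := by
      field_simp
      ring
    rw [h2, h3, div_div_div_cancel_right₀ (mul_ne_zero (pow_ne_zero _ hq0) ha), mul_div_assoc]
  have hr : ∏ j ∈ Finset.range M, q ^ (n + 1 + j) ≠ 0 :=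
    Finset.prod_ne_zero_iff.2 fun j _ => pow_ne_zero _ hq0
  have r1 := qPoch_div_pow_mul_prod q (e / (a * z)) hq0 (by positivity) n M
  have r2 := qPoch_div_pow_mul_prod q (q / (a * z)) hq0 (by positivity) n M
  have e2 : e / (a * z) / q ^ (n + M) = e / z * (q ^ (n + M) * a)⁻¹ := by field_simp
  have e3 : q / (a * z) / q ^ (n + M) = q * (q ^ (n + M) * a)⁻¹ / z := by field_simp
  have e4 : q / (e / (a * z)) = a * z * q / e := by field_simp
  have e5 : q / (q / (a * z)) = a * z := by field_simp
  rw [e2, e4] at r1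
  rw [e3, e5] at r2
  have hp : ∏ j ∈ Finset.range M, (1 - a * z * q ^ (n + j)) ≠ 0 :=
    Finset.prod_ne_zero_iff.2 fun j _ => haz _
  have hn : qPoch (a * z) q n ≠ 0 := Finset.prod_ne_zero_iff.2 fun j _ => haz _
  rw [e1, qPoch_add _ _ n M, qPoch_add _ _ n M, eq_div_iff_mul_eq hr |>.2 r1,
    eq_div_iff_mul_eq hr |>.2 r2]
  have h1 := haz (n + M)
  have e6 : (-(e / (a * z))) ^ M = e ^ M * (-(1 / (a * z))) ^ M := by
    rw [← mul_pow]; congr 1; ring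
  have e7 : (-(q / (a * z))) ^ M = q ^ M * (-(1 / (a * z))) ^ M := by
    rw [← mul_pow]; congr 1; ring
  have h6 : (-(1 / (a * z))) ^ M ≠ 0 := pow_ne_zero _
    (neg_ne_zero.2 (one_div_ne_zero (mul_ne_zero ha hz)))
  rw [e6, e7]
  have hqM : q ^ M ≠ 0 := pow_ne_zero _ hq0
  generalize (-(1 / (a * z))) ^ M = w at *
  field_simp

/-! ### The very-well-poised summand in one more variable -/

open Finset in
/-- The summand of the series without the factors that involve `g`. The factor `g^{-|k|}` of the
power is left out as well, so that the last factor is `(a / E f) ^ |k|`. -/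
noncomputable def seriesCoeff {r : ℕ} (q a c f : ℂ) (e z : Fin r → ℂ) (k : Fin r → ℕ) : ℂ :=
  (∏ i, ∏ j ∈ Ioi i, (z i * q ^ k i - z j * q ^ k j) / (z i - z j))
    * (∏ i, (1 - a * z i * q ^ (k i + ∑ l, k l)) / (1 - a * z i))
    * (∏ i, ∏ j, qPoch (e j * z i / z j) q (k i) / qPoch (q * z i / z j) q (k i))
    * (∏ i, qPoch (a * z i) q (∑ l, k l) / qPoch (a * z i * q / e i) q (∑ l, k l))
    * (∏ i, qPoch (f * z i) q (k i))
    * (1 / qPoch (a * q / f) q (∑ l, k l))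
    * ((1 - c * q ^ (((∑ l, k l : ℕ) : ℤ) - 1)) / (1 - c / q))
    * (∏ i, (1 - a * z i * q ^ (k i + 1) / c) / (1 - a * z i * q / c))
    * (a / ((∏ i, e i) * f)) ^ (∑ l, k l)

open Finset in
/-- With the additional variable `z₀ = q ^ (-N) / a`, the parameters `f` and `e j / z j`, and
`t = a q / c`, the summand of the terminating sum over `k 0 + ... = N` is the summand of the
very-well-poised series with `1 / g = q ^ N`, up to a factor independent of `k`: the differences
`z₀ q^{k 0} - z j q^{k j}` give the very-well-poised part. -/
theorem milneTerm_cons {r : ℕ} (q a c f : ℂ) (e z : Fin r → ℂ)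
    (hq0 : q ≠ 0) (ha0 : a ≠ 0) (hc0 : c ≠ 0) (hf0 : f ≠ 0)
    (he0 : ∀ i, e i ≠ 0) (hz0 : ∀ i, z i ≠ 0) (hq1 : ∀ s : ℕ, q ^ (s + 1) ≠ 1)
    (haz : ∀ i, ∀ s : ℕ, 1 - a * z i * q ^ s ≠ 0)
    (haze : ∀ i, ∀ n : ℕ, qPoch (a * z i * q / e i) q n ≠ 0)
    (haf : ∀ n : ℕ, qPoch (a * q / f) q n ≠ 0)
    (hcq : 1 - c / q ≠ 0) (hazc : ∀ i, 1 - a * z i * q / c ≠ 0)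
    (k : Fin r → ℕ) (M N : ℕ) (hN : ∑ l, k l + M = N) :
    milneTerm q (Fin.cons (q ^ N * a)⁻¹ z : Fin (r + 1) → ℂ)
        (Fin.cons f fun j => e j / z j : Fin (r + 1) → ℂ) (Fin.cons M k : Fin (r + 1) → ℕ)
        * ∏ i, (1 - a * q / c * ((Fin.cons (q ^ N * a)⁻¹ z : Fin (r + 1) → ℂ) i
          * q ^ (Fin.cons M k : Fin (r + 1) → ℕ) i))
      = ((-((∏ i, e i) * f / a)) ^ N * qPoch (a * q / f) q N
          / ((∏ j ∈ range (N + 1), q ^ j) * qPoch q q N)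
          * (∏ j, qPoch (a * z j * q / e j) q N / qPoch (a * z j * q) q N)
          * (-(q / c)) * (1 - c / q) * ∏ j, (1 - a * z j * q / c))
        * (seriesCoeff q a c f e z k * (∏ j ∈ range (∑ l, k l), (q ^ N - q ^ j))
          / ∏ i, qPoch (a * z i * q ^ (N + 1)) q (k i)) := by
  subst hN
  set n := ∑ l, k l with hn
  have hE : ∏ i, e i ≠ 0 := prod_ne_zero_iff.2 fun i _ => he0 i
  have hpow : ∀ s, ∏ j ∈ range s, q ^ j ≠ 0 := fun s =>
    prod_ne_zero_iff.2 fun j _ => pow_ne_zero _ hq0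
  have hqq : ∀ s, qPoch q q s ≠ 0 := fun s => prod_ne_zero_iff.2 fun j _ => by
    rw [← pow_succ']; exact sub_ne_zero.2 (hq1 j).symm
  have hz0' : (q ^ (n + M) * a)⁻¹ ≠ 0 := inv_ne_zero (mul_ne_zero (pow_ne_zero _ hq0) ha0)
  -- the product over pairs of indices together with the columns of the new variable
  have hcol : (∏ j, ((q ^ (n + M) * a)⁻¹ * q ^ M - z j * q ^ k j) / ((q ^ (n + M) * a)⁻¹ - z j))
        * ∏ j, (qPoch (e j / z j * (q ^ (n + M) * a)⁻¹) q M
          / qPoch (q * (q ^ (n + M) * a)⁻¹ / z j) q M)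
      = (∏ j, e j) ^ M * (∏ j, (1 - a * z j * q ^ (k j + n)) / (1 - a * z j))
        * (∏ j, qPoch (a * z j) q n / qPoch (a * z j * q / e j) q n)
        * ∏ j, qPoch (a * z j * q / e j) q (n + M) / qPoch (a * z j * q) q (n + M) := by
    rw [← prod_pow]
    simp only [← prod_mul_distrib]
    refine prod_congr rfl fun j _ => ?_
    rw [milne_column q a (e j) (z j) hq0 ha0 (he0 j) (hz0 j) (haz j) (k j) n M (haze j n)]
    have h1 := qPoch_succ (a * z j) q (n + M)
    rw [qPoch_succ_left] at h1
    have h2 : 1 - a * z j ≠ 0 := by simpa using haz j 0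
    have h3 := haz j (n + M)
    have h4 : qPoch (a * z j) q (n + M) ≠ 0 := prod_ne_zero_iff.2 fun s _ => haz j s
    have h5 : qPoch (a * z j * q) q (n + M) ≠ 0 := prod_ne_zero_iff.2 fun s _ => by
      rw [mul_assoc (a * z j), ← pow_succ']; exact haz j (s + 1)
    have h6 := haze j n
    field_simp
    linear_combination (1 - a * z j * q ^ (k j + n)) * e j ^ M * qPoch (a * z j * q / e j) q (n + M)
      * qPoch (a * z j) q n * h1
  -- the factor that belongs to the additional variable alone
  have hcor : qPoch (f * (q ^ (n + M) * a)⁻¹) q M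
        / qPoch (q * (q ^ (n + M) * a)⁻¹ / (q ^ (n + M) * a)⁻¹) q M
      = (-(f / a)) ^ M * (-1) ^ n * q ^ n * qPoch (a * q / f) q (n + M) / qPoch (a * q / f) q n
        * (∏ j ∈ range n, (q ^ (n + M) - q ^ j))
        / ((∏ j ∈ range (n + M + 1), q ^ j) * qPoch q q (n + M)) := by
    have r1 := qPoch_div_pow_mul_prod q (f / a) hq0 (div_ne_zero hf0 ha0) n M
    have r2 := qPoch_mul_prod_pow_sub_pow q n M
    have r3 := prod_range_pow_split q n M
    have e1 : f / a / q ^ (n + M) = f * (q ^ (n + M) * a)⁻¹ := by field_simp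
    have e2 : q / (f / a) = a * q / f := by field_simp
    have e3 : qPoch (a * q / f) q (n + M) / qPoch (a * q / f) q n
        = ∏ j ∈ range M, (1 - a * q / f * q ^ (n + j)) := by
      rw [qPoch_add, mul_div_cancel_left₀ _ (haf n)]
    have hr : ∏ j ∈ range M, q ^ (n + 1 + j) ≠ 0 :=
      prod_ne_zero_iff.2 fun j _ => pow_ne_zero _ hq0
    rw [e1, e2] at r1
    rw [mul_div_cancel_right₀ _ hz0', mul_div_assoc _ (qPoch (a * q / f) q (n + M)), e3,
      mul_right_comm _ _ (∏ j ∈ range M, (1 - a * q / f * q ^ (n + j))), ← r3,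
      div_eq_div_iff (hqq M) (mul_ne_zero (mul_ne_zero (mul_ne_zero (hpow n)
        (pow_ne_zero _ hq0)) hr) (hqq _))]
    have h1 : (-1 : ℂ) ^ n * (-1) ^ n = 1 := by rw [← mul_pow]; simp
    linear_combination (∏ j ∈ range n, q ^ j) * q ^ n * qPoch q q (n + M) * r1
      - (-(f / a)) ^ M * (∏ j ∈ range M, (1 - a * q / f * q ^ (n + j))) * (-1) ^ n * q ^ n * r2
      - (-(f / a)) ^ M * (∏ j ∈ range M, (1 - a * q / f * q ^ (n + j))) * q ^ n
        * (∏ j ∈ range n, q ^ j) * qPoch q q (n + M) * h1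
  have hlast : q ^ n * (1 - a * q / c * ((q ^ (n + M) * a)⁻¹ * q ^ M))
      = -(q / c) * (1 - c * q ^ ((n : ℤ) - 1)) := by
    rw [zpow_sub_one₀ hq0, zpow_natCast]
    field_simp
    ring
  have hlin : ∏ i, (1 - a * z i * q ^ (k i + 1) / c)
      = ∏ i, (1 - a * q / c * (z i * q ^ k i)) := prod_congr rfl fun i _ => by ring
  have hpows : (-((∏ i, e i) * f / a)) ^ (n + M) * (a / ((∏ i, e i) * f)) ^ n
      = (∏ i, e i) ^ M * (-(f / a)) ^ M * (-1) ^ n := by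
    rw [pow_add, mul_right_comm, ← mul_pow, mul_comm, ← mul_pow]
    congr 2
    · ring
    · field_simp
  have hinv : ∀ i, q * z i / (q ^ (n + M) * a)⁻¹ = a * z i * q ^ (n + M + 1) := fun i => by
    field_simp
    ring
  have h2 : ∏ j, (1 - a * z j * q / c) ≠ 0 := prod_ne_zero_iff.2 fun i _ => hazc i
  rw [milneTerm, seriesCoeff]
  simp only [Fin.prod_univ_succ, Fin.prod_Ioi_zero, Fin.prod_Ioi_succ, Fin.cons_zero, Fin.cons_succ,
    hinv]
  simp only [prod_mul_distrib]
  rw [hcor, prod_div_distrib (f := fun i => qPoch (f * z i) q (k i)), ← hn,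
    prod_div_distrib (f := fun i => 1 - a * z i * q ^ (k i + 1) / c), hlin]
  have hij : ∏ i, ∏ j, qPoch (e j / z j * z i) q (k i) / qPoch (q * z i / z j) q (k i)
      = ∏ i, ∏ j, qPoch (e j * z i / z j) q (k i) / qPoch (q * z i / z j) q (k i) :=
    prod_congr rfl fun i _ => prod_congr rfl fun j _ => by rw [div_mul_eq_mul_div]
  rw [hij]
  -- what remains is a polynomial identity in the products above
  generalize (∏ j, ((q ^ (n + M) * a)⁻¹ * q ^ M - z j * q ^ k j) / ((q ^ (n + M) * a)⁻¹ - z j)) = c1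
    at *
  generalize (∏ j, (qPoch (e j / z j * (q ^ (n + M) * a)⁻¹) q M
          / qPoch (q * (q ^ (n + M) * a)⁻¹ / z j) q M)) = c2 at *
  generalize (∏ i, ∏ j, qPoch (e j * z i / z j) q (k i) / qPoch (q * z i / z j) q (k i)) = c3 at *
  generalize (∏ i, ∏ j ∈ Ioi i, (z i * q ^ k i - z j * q ^ k j) / (z i - z j)) = c4 at *
  generalize (∏ j, (1 - a * z j * q ^ (k j + n)) / (1 - a * z j)) = c5 at *
  generalize (∏ j, qPoch (a * z j) q n / qPoch (a * z j * q / e j) q n) = c6 at *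
  generalize ∏ j, qPoch (a * z j * q / e j) q (n + M) / qPoch (a * z j * q) q (n + M) = c7 at *
  generalize ∏ j, (1 - a * z j * q / c) = c8 at *
  generalize ∏ i, (1 - a * q / c * (z i * q ^ k i)) = c9 at *
  generalize (∏ i, qPoch (f * z i) q (k i)) = c10 at *
  generalize (∏ i, qPoch (a * z i * q ^ (n + M + 1)) q (k i)) = c11 at *
  generalize 1 - c / q = c12 at *
  generalize (1 - c * q ^ ((n : ℤ) - 1)) = c13 at *
  generalize (1 - a * q / c * ((q ^ (n + M) * a)⁻¹ * q ^ M)) = c14 at *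
  generalize (∏ j ∈ range n, (q ^ (n + M) - q ^ j)) = c15 at *
  generalize (∏ j ∈ range (n + M + 1), q ^ j) = c16 at *
  generalize qPoch (a * q / f) q (n + M) = c17 at *
  generalize qPoch (a * q / f) q n = c18 at *
  generalize qPoch q q (n + M) = c19 at *
  generalize (-((∏ i, e i) * f / a)) ^ (n + M) = d1 at *
  generalize (a / ((∏ i, e i) * f)) ^ n = d2 at *
  generalize (∏ i, e i) ^ M = d3 at *
  generalize (-(f / a)) ^ M = d4 at *
  generalize (-1 : ℂ) ^ n = d5 at *
  calc _ = (c1 * c2) * (q ^ n * c14) * (d4 * d5) * c3 * c4 * c9 * c10 * c15 * c17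
        / (c11 * c16 * c18 * c19) := by ring
    _ = (d3 * d4 * d5) * c5 * c6 * c7 * (-(q / c) * c13) * c3 * c4 * c9 * c10 * c15 * c17
        / (c11 * c16 * c18 * c19) := by rw [hcol, hlast]; ring
    _ = (d1 * d2) * c5 * c6 * c7 * (-(q / c) * (c12 * (c13 / c12))) * c3 * c4
        * (c8 * (c9 / c8)) * c10 * c15 * c17 / (c11 * c16 * c18 * c19) := by
        rw [← hpows, mul_div_cancel₀ _ hcq, mul_div_cancel₀ _ h2]
    _ = _ := by ring

/-! ### The terminating sum for generic `a` -/

theorem QGeneric.cons {r : ℕ} {q a : ℂ} {z : Fin r → ℂ} (h : QGeneric q z) (ha0 : a ≠ 0)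
    (haz : ∀ i, ∀ s t : ℕ, a * z i * q ^ s ≠ q ^ t) (N : ℕ) :
    QGeneric q (Fin.cons (q ^ N * a)⁻¹ z : Fin (r + 1) → ℂ) where
  q_ne_zero := h.q_ne_zero
  ne_zero i := by
    refine Fin.cases ?_ (fun i => ?_) i
    · exact inv_ne_zero (mul_ne_zero (pow_ne_zero _ h.q_ne_zero) ha0)
    · exact h.ne_zero i
  pow_ne_one := h.pow_ne_one
  ne i j hij s t := by
    have key : ∀ i, ∀ s t : ℕ, (q ^ N * a)⁻¹ * q ^ s ≠ z i * q ^ t := fun i s t h0 => by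
      refine haz i (t + N) s ?_
      have hqN : q ^ N ≠ 0 := pow_ne_zero _ h.q_ne_zero
      rw [pow_add]
      field_simp at h0
      linear_combination -h0
    revert hij
    refine Fin.cases ?_ (fun i => ?_) i <;> refine Fin.cases ?_ (fun j => ?_) j
    · exact fun hij => absurd rfl hij
    · exact fun _ => key j s t
    · exact fun _ => (key i t s).symm
    · exact fun hij => h.ne i j (fun h0 => hij (congrArg _ h0)) s t

/-- The bracket on the right-hand side together with `(1 - c / g q) / (1 - c / q)`, as a function of
`u = 1 / g`. It is written so that it is visibly a polynomial in `u`. -/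
noncomputable def boundaryFactor {r : ℕ} (q a c f : ℂ) (e z : Fin r → ℂ) (u : ℂ) : ℂ :=
  (1 - c * u / q - (1 - u) * (1 - c * f / (a * q)) / (1 - (∏ i, e i) * f / a)
    * ∏ i, (1 - c * e i / (a * z i * q)) / (1 - c / (a * z i * q))) / (1 - c / q)

open Finset in
/-- The terminating case `1 / g = q ^ N`, for `a` such that the additional variable
`q ^ (-N) / a` differs from all `z i` modulo powers of `q`. The index set consists of the tuples
`(N - |k|, k)` with `|k| ≤ N`. -/
theorem sum_seriesCoeff_of_generic {r : ℕ} (q a c f : ℂ) (e z : Fin r → ℂ) (h : QGeneric q z)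
    (ha0 : a ≠ 0) (hc0 : c ≠ 0) (hf0 : f ≠ 0) (he0 : ∀ i, e i ≠ 0)
    (haz : ∀ i, ∀ s t : ℕ, a * z i * q ^ s ≠ q ^ t)
    (haze : ∀ i, ∀ n : ℕ, qPoch (a * z i * q / e i) q n ≠ 0)
    (haf : ∀ n : ℕ, qPoch (a * q / f) q n ≠ 0)
    (hcq : 1 - c / q ≠ 0) (hazc : ∀ i, 1 - a * z i * q / c ≠ 0)
    (hEfa : 1 - (∏ i, e i) * f / a ≠ 0) {N : ℕ} (hN : N ≠ 0) :
    ∑ K ∈ piAntidiag (univ : Finset (Fin (r + 1))) N,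
        seriesCoeff q a c f e z (Fin.tail K)
          * (∏ j ∈ range (∑ l, Fin.tail K l), (q ^ N - q ^ j))
          / ∏ i, qPoch (a * z i * q ^ (N + 1)) q (Fin.tail K i)
      = boundaryFactor q a c f e z (q ^ N) * (qPoch (a / ((∏ i, e i) * f)) q N
          / qPoch (a * q / f) q N)
        * ∏ i, qPoch (a * z i * q) q N / qPoch (a * z i * q / e i) q N := by
  have hq0 := h.q_ne_zero
  have haz' : ∀ i, ∀ s : ℕ, 1 - a * z i * q ^ s ≠ 0 := fun i s =>
    sub_ne_zero.2 (by simpa using (haz i s 0).symm)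
  have hE : ∏ i, e i ≠ 0 := prod_ne_zero_iff.2 fun i _ => he0 i
  have hgen := h.cons ha0 haz N
  obtain ⟨N', rfl⟩ := Nat.exists_eq_succ_of_ne_zero hN
  have main := hgen.qPoch_mul_sum_milneTerm_mul_prod
    (Fin.cons f fun j => e j / z j : Fin (r + 1) → ℂ) (a * q / c) N'
  rw [Nat.succ_eq_add_one] at *
  set N := N' + 1 with hNN
  have hterm : ∀ K ∈ piAntidiag (univ : Finset (Fin (r + 1))) N, _ := fun K hK =>
    milneTerm_cons q a c f e z hq0 ha0 hc0 hf0 he0 h.ne_zero h.pow_ne_one haz' haze haf hcq hazc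
      (Fin.tail K) (K 0) N (by
        rw [← (mem_piAntidiag.1 hK).1, Fin.sum_univ_succ, add_comm]
        rfl)
  simp only [Fin.cons_self_tail] at hterm
  rw [sum_congr rfl hterm, ← mul_sum] at main
  have hA : ∏ i, (Fin.cons f (fun j => e j / z j) : Fin (r + 1) → ℂ) i
        * (Fin.cons (q ^ N * a)⁻¹ z : Fin (r + 1) → ℂ) i
      = (∏ i, e i) * f / a / q ^ N := by
    simp only [Fin.prod_univ_succ, Fin.cons_zero, Fin.cons_succ]
    rw [prod_congr rfl fun i _ => div_mul_cancel₀ (e i) (h.ne_zero i)]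
    field_simp
  have hP : ∏ i, (1 - a * q / c * (Fin.cons (q ^ N * a)⁻¹ z : Fin (r + 1) → ℂ) i)
      = (1 - q / (c * q ^ N)) * ∏ i, (1 - a * z i * q / c) := by
    simp only [Fin.prod_univ_succ, Fin.cons_zero, Fin.cons_succ]
    congr 1
    · field_simp
    · exact prod_congr rfl fun i _ => by ring
  have hQ : ∏ i, ((Fin.cons f (fun j => e j / z j) : Fin (r + 1) → ℂ) i
        * (Fin.cons (q ^ N * a)⁻¹ z : Fin (r + 1) → ℂ) i
        - a * q / c * (Fin.cons (q ^ N * a)⁻¹ z : Fin (r + 1) → ℂ) i)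
      = (-(q / c) * (1 - c * f / (a * q)) / q ^ N)
        * ((∏ i, (1 - a * z i * q / c))
          * ∏ i, (1 - c * e i / (a * z i * q)) / (1 - c / (a * z i * q))) := by
    simp only [Fin.prod_univ_succ, Fin.cons_zero, Fin.cons_succ]
    rw [← prod_mul_distrib]
    congr 1
    · field_simp
      ring
    · refine prod_congr rfl fun i _ => ?_
      have h1 := h.ne_zero i
      have h2 := hazc i
      have h3 : 1 - c / (a * z i * q) = -(c / (a * z i * q)) * (1 - a * z i * q / c) := by
        field_simp
        ring
      have h4 : c / (a * z i * q) ≠ 0 := div_ne_zero hc0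
        (mul_ne_zero (mul_ne_zero ha0 h1) hq0)
      rw [h3, mul_div_assoc', mul_comm (-(c / (a * z i * q))), mul_div_mul_left _ _ h2]
      field_simp
      ring
  have hAq : (∏ i, e i) * f / a / q ^ N * q = (q * ((∏ i, e i) * f / a)) / q ^ (0 + N) := by
    rw [zero_add]; ring
  have hy : (∏ i, e i) * f / a ≠ 0 := div_ne_zero (mul_ne_zero hE hf0) ha0
  -- the value of the sum contains `(E f q ^ (1 - N) / a; q)_N`, which is reversed here
  have hrev := qPoch_div_pow_mul_prod q (q * ((∏ i, e i) * f / a)) hq0 (mul_ne_zero hq0 hy) 0 N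
  have hyinv : q / (q * ((∏ i, e i) * f / a)) = a / ((∏ i, e i) * f) := by field_simp
  have hsplit := prod_range_pow_split q 0 N
  simp only [zero_add, prod_range_zero, one_mul, pow_zero] at hrev hsplit hAq
  rw [hyinv, hsplit] at hrev
  change _ = _ * qPoch (a / ((∏ i, e i) * f)) q N at hrev
  have hstep : qPoch ((∏ i, e i) * f / a / q ^ N * q) q N
      = qPoch ((∏ i, e i) * f / a / q ^ N * q) q N' * (1 - (∏ i, e i) * f / a) := by
    rw [hNN, qPoch_succ, ← hNN]
    congr 2
    rw [hNN, pow_succ]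
    have := pow_ne_zero N' hq0
    field_simp
  have hN' : qPoch ((∏ i, e i) * f / a / q ^ N * q) q N'
      = qPoch ((∏ i, e i) * f / a / q ^ N * q) q N / (1 - (∏ i, e i) * f / a) :=
    eq_div_of_mul_eq hEfa hstep.symm
  rw [hA, hP, hQ, hN', hAq] at main
  have hpow : ∏ j ∈ range (N + 1), q ^ j ≠ 0 :=
    prod_ne_zero_iff.2 fun j _ => pow_ne_zero _ hq0
  rw [eq_div_of_mul_eq hpow hrev] at main
  have hqq : qPoch q q N ≠ 0 := prod_ne_zero_iff.2 fun j _ => by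
    rw [← pow_succ']; exact sub_ne_zero.2 (h.pow_ne_one j).symm
  have hazq : ∏ i, qPoch (a * z i * q) q N ≠ 0 := prod_ne_zero_iff.2 fun i _ =>
    prod_ne_zero_iff.2 fun s _ => by
      rw [mul_assoc (a * z i), ← pow_succ']; exact haz' i (s + 1)
  have hazeN : ∏ i, qPoch (a * z i * q / e i) q N ≠ 0 := prod_ne_zero_iff.2 fun i _ => haze i N
  have hazcN : ∏ i, (1 - a * z i * q / c) ≠ 0 := prod_ne_zero_iff.2 fun i _ => hazc i
  have hafN := haf N
  have hqN : q ^ N ≠ 0 := pow_ne_zero _ hq0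
  have hyN : (-((∏ i, e i) * f / a)) ^ N ≠ 0 := pow_ne_zero _ (neg_ne_zero.2 hy)
  have hy' : (-(q * ((∏ i, e i) * f / a))) ^ N = q ^ N * (-((∏ i, e i) * f / a)) ^ N := by
    rw [← mul_pow]; ring
  have hb : 1 - q / (c * q ^ N) = -(q / c) * (1 - c * q ^ N / q) / q ^ N := by
    field_simp
    ring
  have hqc : -(q / c) ≠ 0 := neg_ne_zero.2 (div_ne_zero hq0 hc0)
  rw [hy', hb] at main
  rw [boundaryFactor]
  simp only [prod_div_distrib (f := fun i => qPoch (a * z i * q) q N),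
    prod_div_distrib (f := fun i => qPoch (a * z i * q / e i) q N)] at main ⊢
  generalize (∑ K ∈ piAntidiag (univ : Finset (Fin (r + 1))) N,
        seriesCoeff q a c f e z (Fin.tail K)
          * (∏ j ∈ range (∑ l, Fin.tail K l), (q ^ N - q ^ j))
          / ∏ i, qPoch (a * z i * q ^ (N + 1)) q (Fin.tail K i)) = S at main ⊢
  generalize (∏ i, (1 - c * e i / (a * z i * q)) / (1 - c / (a * z i * q))) = R at main ⊢
  generalize (-((∏ i, e i) * f / a)) ^ N = w at main hyN
  generalize 1 - (∏ i, e i) * f / a = b1 at main hEfa ⊢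
  generalize 1 - c * f / (a * q) = b2 at main ⊢
  generalize 1 - c / q = b3 at main hcq ⊢
  generalize ∏ i, (1 - a * z i * q / c) = b4 at main hazcN
  generalize -(q / c) = b5 at main hqc
  generalize ∏ i, qPoch (a * z i * q / e i) q N = b6 at main hazeN ⊢
  generalize ∏ i, qPoch (a * z i * q) q N = b7 at main hazq ⊢
  generalize ∏ j ∈ range (N + 1), q ^ j = b8 at main hpow
  generalize qPoch (a / ((∏ i, e i) * f)) q N = b9 at main ⊢
  generalize qPoch (a * q / f) q N = b10 at main hafN ⊢
  generalize qPoch q q N = b11 at main hqq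
  have hX : w * b5 * b4 ≠ 0 := mul_ne_zero (mul_ne_zero hyN hqc) hazcN
  have main' : (w * b5 * b4) * (b10 * b6 * b3 * S)
      = (w * b5 * b4) * (b7 * b9 * (1 - c * q ^ N / q - (1 - q ^ N) * b2 / b1 * R)) := by
    field_simp at main ⊢
    linear_combination main
  have main'' := mul_left_cancel₀ hX main'
  field_simp at main'' ⊢
  linear_combination main''

open Filter Topology

/-! ### The terminating sum for all `a` -/

theorem continuous_qPoch (q : ℂ) (n : ℕ) : Continuous fun x => qPoch x q n := by
  unfold qPoch
  fun_prop

theorem continuousAt_seriesCoeff {r : ℕ} (q a c f : ℂ) (e z : Fin r → ℂ) (k : Fin r → ℕ)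
    (haz : ∀ i, 1 - a * z i ≠ 0)
    (haze : ∀ i, ∀ n : ℕ, qPoch (a * z i * q / e i) q n ≠ 0)
    (haf : ∀ n : ℕ, qPoch (a * q / f) q n ≠ 0) (hazc : ∀ i, 1 - a * z i * q / c ≠ 0) :
    ContinuousAt (fun b => seriesCoeff q b c f e z k) a := by
  have hp : ∀ w n, ContinuousAt (fun b => qPoch (b * w) q n) a := fun w n =>
    ((continuous_qPoch q n).comp (continuous_mul_const w)).continuousAt
  have h1 : ContinuousAt (fun b => ∏ i, (1 - b * z i * q ^ (k i + ∑ l, k l)) / (1 - b * z i)) a :=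
    tendsto_finsetProd _ fun i _ =>
      ContinuousAt.div (f := fun b => 1 - b * z i * q ^ (k i + ∑ l, k l)) (by fun_prop)
        (by fun_prop) (haz i)
  have h2 : ContinuousAt (fun b => ∏ i, qPoch (b * z i) q (∑ l, k l)
      / qPoch (b * z i * q / e i) q (∑ l, k l)) a :=
    tendsto_finsetProd _ fun i _ =>
      ContinuousAt.div (f := fun b => qPoch (b * z i) q (∑ l, k l)) (hp _ _)
        (by simpa only [mul_div_assoc, mul_assoc] using hp (z i * (q / e i)) (∑ l, k l)) (haze i _)
  have h3 : ContinuousAt (fun b => 1 / qPoch (b * q / f) q (∑ l, k l)) a :=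
    ContinuousAt.div (f := fun _ => 1) continuousAt_const
      (by simpa only [mul_div_assoc] using hp (q / f) (∑ l, k l)) (haf _)
  have h4 : ContinuousAt (fun b => ∏ i, (1 - b * z i * q ^ (k i + 1) / c)
      / (1 - b * z i * q / c)) a :=
    tendsto_finsetProd _ fun i _ =>
      ContinuousAt.div (f := fun b => 1 - b * z i * q ^ (k i + 1) / c) (by fun_prop)
        (by fun_prop) (hazc i)
  have h5 : ContinuousAt (fun b => (b / ((∏ i, e i) * f)) ^ (∑ l, k l)) a := by fun_prop
  unfold seriesCoeff
  exact ((((((((continuousAt_const.mul h1).mul continuousAt_const).mul h2).mul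
    continuousAt_const).mul h3).mul continuousAt_const).mul h4).mul h5)

theorem continuousAt_boundaryFactor {r : ℕ} (q a c f : ℂ) (e z : Fin r → ℂ) (u : ℂ)
    (ha0 : a ≠ 0) (hq0 : q ≠ 0) (hz0 : ∀ i, z i ≠ 0) (hazc : ∀ i, 1 - a * z i * q / c ≠ 0)
    (hEfa : 1 - (∏ i, e i) * f / a ≠ 0) :
    ContinuousAt (fun b => boundaryFactor q b c f e z u) a := by
  have h0 : ∀ i, a * z i * q ≠ 0 := fun i => mul_ne_zero (mul_ne_zero ha0 (hz0 i)) hq0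
  have h1 : ContinuousAt (fun b => 1 - c * f / (b * q)) a :=
    continuousAt_const.sub (continuousAt_const.div (continuousAt_id.mul continuousAt_const)
      (mul_ne_zero ha0 hq0))
  have h2 : ContinuousAt (fun b => 1 - (∏ i, e i) * f / b) a :=
    continuousAt_const.sub (continuousAt_const.div continuousAt_id ha0)
  have h3 : ∀ w i, ContinuousAt (fun b => 1 - w / (b * z i * q)) a := fun w i =>
    continuousAt_const.sub (continuousAt_const.div
      ((continuousAt_id.mul continuousAt_const).mul continuousAt_const) (h0 i))
  have h4 : ContinuousAt
      (fun b => ∏ i, (1 - c * e i / (b * z i * q)) / (1 - c / (b * z i * q))) a :=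
    tendsto_finsetProd _ fun i _ => ContinuousAt.div (h3 _ i) (h3 _ i) (fun h5 => hazc i (by
      have h6 := h0 i
      have h7 : c ≠ 0 := by
        rintro rfl
        simp at h5
      rw [sub_eq_zero, eq_div_iff h6, one_mul] at h5
      rw [h5, div_self h7, sub_self]))
  unfold boundaryFactor
  exact (continuousAt_const.sub (((continuousAt_const.mul h1).div h2 hEfa).mul h4)).div_const _

open Finset in
/-- The terminating case without the genericity assumption on `a`: both sides are continuous in
`a`, and only countably many values are exceptional. -/
theorem sum_seriesCoeff {r : ℕ} (q a c f : ℂ) (e z : Fin r → ℂ) (h : QGeneric q z)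
    (ha0 : a ≠ 0) (hc0 : c ≠ 0) (hf0 : f ≠ 0) (he0 : ∀ i, e i ≠ 0)
    (haz : ∀ i, 1 - a * z i ≠ 0)
    (haze : ∀ i, ∀ n : ℕ, qPoch (a * z i * q / e i) q n ≠ 0)
    (haf : ∀ n : ℕ, qPoch (a * q / f) q n ≠ 0)
    (hcq : 1 - c / q ≠ 0) (hazc : ∀ i, 1 - a * z i * q / c ≠ 0)
    (hEfa : 1 - (∏ i, e i) * f / a ≠ 0) {N : ℕ} (hN : N ≠ 0)
    (hazN : ∀ i, ∀ n : ℕ, qPoch (a * z i * q ^ (N + 1)) q n ≠ 0) :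
    ∑ K ∈ piAntidiag (univ : Finset (Fin (r + 1))) N,
        seriesCoeff q a c f e z (Fin.tail K)
          * (∏ j ∈ range (∑ l, Fin.tail K l), (q ^ N - q ^ j))
          / ∏ i, qPoch (a * z i * q ^ (N + 1)) q (Fin.tail K i)
      = boundaryFactor q a c f e z (q ^ N) * (qPoch (a / ((∏ i, e i) * f)) q N
          / qPoch (a * q / f) q N)
        * ∏ i, qPoch (a * z i * q) q N / qPoch (a * z i * q / e i) q N := by
  have hq0 := h.q_ne_zero
  have hp : ∀ w n, ContinuousAt (fun b => qPoch (b * w) q n) a := fun w n =>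
    ((continuous_qPoch q n).comp (continuous_mul_const w)).continuousAt
  -- the exceptional values of `a`
  set B : Set ℂ := {0, (∏ i, e i) * f} ∪ Set.range (fun p : Fin r × ℕ × ℕ =>
      q ^ p.2.2 / (z p.1 * q ^ p.2.1)) ∪ Set.range (fun p : Fin r × ℕ =>
      e p.1 / (z p.1 * q * q ^ p.2)) ∪ Set.range (fun s : ℕ => f / (q * q ^ s))
      ∪ Set.range (fun i : Fin r => c / (z i * q)) with hB
  have hBc : B.Countable :=
    (((((Set.countable_singleton _).insert _).union (Set.countable_range _)).union
      (Set.countable_range _)).union (Set.countable_range _)).union (Set.countable_range _)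
  have hgen : ∀ b ∈ Bᶜ, ∑ K ∈ piAntidiag (univ : Finset (Fin (r + 1))) N,
        seriesCoeff q b c f e z (Fin.tail K)
          * (∏ j ∈ range (∑ l, Fin.tail K l), (q ^ N - q ^ j))
          / ∏ i, qPoch (b * z i * q ^ (N + 1)) q (Fin.tail K i)
      = boundaryFactor q b c f e z (q ^ N) * (qPoch (b / ((∏ i, e i) * f)) q N
          / qPoch (b * q / f) q N)
        * ∏ i, qPoch (b * z i * q) q N / qPoch (b * z i * q / e i) q N := by
    intro b hb
    simp only [hB, Set.mem_compl_iff, Set.mem_union, Set.mem_insert_iff, Set.mem_singleton_iff,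
      Set.mem_range, not_or, not_exists, Prod.forall] at hb
    obtain ⟨⟨⟨⟨⟨hb0, hb1⟩, hb2⟩, hb3⟩, hb4⟩, hb5⟩ := hb
    refine sum_seriesCoeff_of_generic q b c f e z h hb0 hc0 hf0 he0 ?_ ?_ ?_ hcq ?_ ?_ hN
    · intro i s t h0
      exact hb2 i s t (by rw [← h0, mul_assoc, mul_div_cancel_right₀ _ (h.mul_pow_ne_zero i s)])
    · refine fun i n => prod_ne_zero_iff.2 fun s _ h0 => hb3 i s ?_
      have h1 := h.ne_zero i
      have h2 := he0 i
      field_simp at h0 ⊢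
      linear_combination h0
    · refine fun n => prod_ne_zero_iff.2 fun s _ h0 => hb4 s ?_
      field_simp at h0 ⊢
      linear_combination h0
    · intro i h0
      refine hb5 i ?_
      have h1 := h.ne_zero i
      field_simp at h0 ⊢
      linear_combination h0
    · intro h0
      refine hb1 ?_
      field_simp at h0
      linear_combination h0
  have hd : Dense Bᶜ := hBc.dense_compl ℝ
  have : (𝓝[Bᶜ] a).NeBot := mem_closure_iff_nhdsWithin_neBot.1 (hd a)
  refine tendsto_nhds_unique_of_eventuallyEq (l := 𝓝[Bᶜ] a)
    (f := fun b => ∑ K ∈ piAntidiag (univ : Finset (Fin (r + 1))) N,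
        seriesCoeff q b c f e z (Fin.tail K)
          * (∏ j ∈ range (∑ l, Fin.tail K l), (q ^ N - q ^ j))
          / ∏ i, qPoch (b * z i * q ^ (N + 1)) q (Fin.tail K i))
    (g := fun b => boundaryFactor q b c f e z (q ^ N) * (qPoch (b / ((∏ i, e i) * f)) q N
          / qPoch (b * q / f) q N)
        * ∏ i, qPoch (b * z i * q) q N / qPoch (b * z i * q / e i) q N)
    (Tendsto.mono_left ?_ nhdsWithin_le_nhds) (Tendsto.mono_left ?_ nhdsWithin_le_nhds)
    (eventually_nhdsWithin_of_forall hgen)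
  · refine tendsto_finsetSum _ fun K _ => ?_
    refine Tendsto.div ((continuousAt_seriesCoeff q a c f e z _ haz haze haf hazc).mul
      continuousAt_const) (tendsto_finsetProd _ fun i _ => ?_)
      (prod_ne_zero_iff.2 fun i _ => hazN i _)
    simpa only [mul_assoc] using (hp (z i * q ^ (N + 1)) (Fin.tail K i)).tendsto
  · refine Tendsto.mul (Tendsto.mul ?_ (Tendsto.div ?_ ?_ (haf N)))
      (tendsto_finsetProd _ fun i _ => Tendsto.div ?_ ?_ (haze i N))
    · exact continuousAt_boundaryFactor q a c f e z _ ha0 hq0 h.ne_zero hazc hEfa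
    · simpa only [div_eq_mul_inv] using (hp ((∏ i, e i) * f)⁻¹ N).tendsto
    · simpa only [mul_div_assoc] using (hp (q / f) N).tendsto
    · simpa only [mul_assoc] using (hp (z i * q) N).tendsto
    · simpa only [mul_div_assoc, mul_assoc] using (hp (z i * (q / e i)) N).tendsto

/-! ### Infinite products and bounds -/

theorem summable_norm_mul_pow (x q : ℂ) (hq : ‖q‖ < 1) : Summable fun j : ℕ => ‖-(x * q ^ j)‖ := by
  simpa [norm_mul, norm_pow] using
    (summable_geometric_of_lt_one (norm_nonneg q) hq).mul_left ‖x‖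

theorem qPochInf_ne_zero {x q : ℂ} (hq : ‖q‖ < 1) (h : ∀ j : ℕ, 1 - x * q ^ j ≠ 0) :
    qPochInf x q ≠ 0 := by
  simpa only [qPochInf, sub_eq_add_neg] using tprod_one_add_ne_zero_of_summable
    (f := fun j : ℕ => -(x * q ^ j)) (by simpa only [sub_eq_add_neg] using h)
    (summable_norm_mul_pow x q hq)

theorem qPochInf_ne_zero_of_qPoch {x q : ℂ} (hq : ‖q‖ < 1) (h : ∀ n, qPoch x q n ≠ 0) :
    qPochInf x q ≠ 0 :=
  qPochInf_ne_zero hq fun j h0 => h (j + 1) (by rw [qPoch_succ, h0, mul_zero])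

theorem one_sub_mul_pow_ne_zero {x q : ℂ} (hq : ‖q‖ < 1) (hx : ‖x‖ < 1) (j : ℕ) :
    1 - x * q ^ j ≠ 0 := by
  intro h
  have h1 : ‖x * q ^ j‖ = 1 := by rw [← sub_eq_zero.1 h, norm_one]
  have h2 : ‖x * q ^ j‖ < 1 := by
    rw [norm_mul, norm_pow]
    exact mul_lt_one_of_nonneg_of_lt_one_left (norm_nonneg _) hx
      (pow_le_one₀ (norm_nonneg _) hq.le)
  exact h2.ne h1

theorem tendsto_qPoch (x q : ℂ) (hq : ‖q‖ < 1) :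
    Tendsto (qPoch x q) atTop (𝓝 (qPochInf x q)) :=
  (qPochInf_multipliable x q hq).hasProd.tendsto_prod_nat

theorem exists_norm_qPoch_le (x q : ℂ) (hq : ‖q‖ < 1) : ∃ C, ∀ n, ‖qPoch x q n‖ ≤ C := by
  obtain ⟨C, hC⟩ := (Metric.isBounded_range_of_tendsto _ (tendsto_qPoch x q hq)).exists_norm_le
  exact ⟨C, fun n => hC _ ⟨n, rfl⟩⟩

theorem exists_norm_inv_qPoch_le (x q : ℂ) (hq : ‖q‖ < 1) (h : ∀ n, qPoch x q n ≠ 0) :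
    ∃ C, ∀ n, ‖(qPoch x q n)⁻¹‖ ≤ C := by
  obtain ⟨C, hC⟩ := (Metric.isBounded_range_of_tendsto _ ((tendsto_qPoch x q hq).inv₀
    (qPochInf_ne_zero_of_qPoch hq h))).exists_norm_le
  exact ⟨C, fun n => hC _ ⟨n, rfl⟩⟩

theorem differentiable_qPochInf (q : ℂ) (hq : ‖q‖ < 1) :
    Differentiable ℂ fun x => qPochInf x q := by
  intro x₀
  have hU : IsOpen (Metric.ball (0 : ℂ) (‖x₀‖ + 1)) := Metric.isOpen_ball
  have hsum : Summable fun j : ℕ => (‖x₀‖ + 1) * ‖q‖ ^ j :=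
    (summable_geometric_of_lt_one (norm_nonneg q) hq).mul_left _
  have hprod : HasProdLocallyUniformlyOn (fun (j : ℕ) x => 1 + -(x * q ^ j))
      (fun x => ∏' j : ℕ, (1 + -(x * q ^ j))) (Metric.ball (0 : ℂ) (‖x₀‖ + 1)) := by
    refine hsum.hasProdLocallyUniformlyOn_nat_one_add hU (Eventually.of_forall fun j x hx => ?_)
      fun j => by fun_prop
    rw [norm_neg, norm_mul, norm_pow]
    exact mul_le_mul_of_nonneg_right (mem_ball_zero_iff.1 hx).le (by positivity)
  have hd := hprod.differentiableOn (Eventually.of_forall fun s => by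
    simpa [Finset.prod_fn] using DifferentiableOn.finsetProd (fun _ _ => by fun_prop)) hU
  have h1 := hd.differentiableAt (hU.mem_nhds (mem_ball_zero_iff.2 (lt_add_one ‖x₀‖)))
  simpa only [qPochInf, sub_eq_add_neg] using h1

theorem summable_pow_sum (r : ℕ) {x : ℝ} (hx0 : 0 ≤ x) (hx : x < 1) :
    Summable fun k : Fin r → ℕ => x ^ ∑ l, k l := by
  induction r with
  | zero => exact Summable.of_finite
  | succ r ih =>
    have h1 := (summable_geometric_of_lt_one hx0 hx).mul_of_nonneg ih
      (fun _ => by positivity) (fun _ => by positivity)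
    rw [← (Fin.consEquiv fun _ => ℕ).summable_iff]
    refine h1.congr fun p => ?_
    simp [Fin.consEquiv, Fin.sum_univ_succ, pow_add]

theorem exists_norm_prod_le {ι κ : Type*} (s : Finset κ) (F : κ → ι → ℂ)
    (h : ∀ i ∈ s, ∃ C, ∀ k, ‖F i k‖ ≤ C) : ∃ C, ∀ k, ‖∏ i ∈ s, F i k‖ ≤ C := by
  choose! C hC using h
  refine ⟨∏ i ∈ s, C i, fun k => ?_⟩
  rw [norm_prod]
  exact Finset.prod_le_prod (fun _ _ => norm_nonneg _) fun i hi => hC i hi k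

theorem exists_norm_mul_le {ι : Type*} {F G : ι → ℂ} (hF : ∃ C, ∀ k, ‖F k‖ ≤ C)
    (hG : ∃ C, ∀ k, ‖G k‖ ≤ C) : ∃ C, ∀ k, ‖F k * G k‖ ≤ C := by
  obtain ⟨C, hC⟩ := hF
  obtain ⟨D, hD⟩ := hG
  refine ⟨C * D, fun k => ?_⟩
  rw [norm_mul]
  exact mul_le_mul (hC k) (hD k) (norm_nonneg _) ((norm_nonneg _).trans (hC k))

theorem exists_norm_div_const_le {ι : Type*} {F : ι → ℂ} (hF : ∃ C, ∀ k, ‖F k‖ ≤ C) (w : ℂ) :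
    ∃ C, ∀ k, ‖F k / w‖ ≤ C := by
  simpa only [div_eq_mul_inv] using exists_norm_mul_le hF ⟨‖w⁻¹‖, fun _ => le_rfl⟩

theorem exists_norm_sub_mul_pow_le {ι : Type*} {q : ℂ} (hq : ‖q‖ < 1) (v w : ι → ℂ)
    (hv : ∃ C, ∀ k, ‖v k‖ ≤ C) (hw : ∃ C, ∀ k, ‖w k‖ ≤ C) (m : ι → ℕ) :
    ∃ C, ∀ k, ‖v k - w k * q ^ m k‖ ≤ C := by
  obtain ⟨C, hC⟩ := hv
  obtain ⟨D, hD⟩ := hw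
  refine ⟨C + D, fun k => (norm_sub_le _ _).trans (add_le_add (hC k) ?_)⟩
  rw [norm_mul, norm_pow]
  exact (mul_le_of_le_one_right (norm_nonneg _) (pow_le_one₀ (norm_nonneg _) hq.le)).trans (hD k)

/-- All factors of `seriesCoeff` but the last power are bounded, since `q`-shifted factorials
converge as their length tends to infinity, to a nonzero limit if no factor vanishes. -/
theorem exists_norm_seriesCoeff_le {r : ℕ} (q a c f : ℂ) (e z : Fin r → ℂ) (hq : ‖q‖ < 1)
    (hq0 : q ≠ 0)
    (hqzz : ∀ i j, ∀ n : ℕ, qPoch (q * z i / z j) q n ≠ 0)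
    (haze : ∀ i, ∀ n : ℕ, qPoch (a * z i * q / e i) q n ≠ 0)
    (haf : ∀ n : ℕ, qPoch (a * q / f) q n ≠ 0) :
    ∃ C, ∀ k : Fin r → ℕ,
      ‖seriesCoeff q a c f e z k‖ ≤ C * ‖a / ((∏ i, e i) * f)‖ ^ ∑ l, k l := by
  have hone : ∀ (w : ℂ) (m : (Fin r → ℕ) → ℕ), ∃ C, ∀ k, ‖1 - w * q ^ m k‖ ≤ C := fun w m =>
    exists_norm_sub_mul_pow_le hq (fun _ => 1) (fun _ => w) ⟨_, fun _ => le_rfl⟩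
      ⟨_, fun _ => le_rfl⟩ m
  have hpoch : ∀ (w : ℂ) (m : (Fin r → ℕ) → ℕ), ∃ C, ∀ k, ‖qPoch w q (m k)‖ ≤ C := fun w m =>
    let ⟨C, hC⟩ := exists_norm_qPoch_le w q hq
    ⟨C, fun k => hC (m k)⟩
  have hinv : ∀ (w : ℂ) (m : (Fin r → ℕ) → ℕ), (∀ n, qPoch w q n ≠ 0) →
      ∃ C, ∀ k, ‖(qPoch w q (m k))⁻¹‖ ≤ C := fun w m hw =>
    let ⟨C, hC⟩ := exists_norm_inv_qPoch_le w q hq hw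
    ⟨C, fun k => hC (m k)⟩
  have hpow : ∀ (w : ℂ) (i : Fin r), ∃ C, ∀ k : Fin r → ℕ, ‖w * q ^ k i‖ ≤ C := fun w i =>
    ⟨‖w‖, fun k => by
      rw [norm_mul, norm_pow]
      exact mul_le_of_le_one_right (norm_nonneg _) (pow_le_one₀ (norm_nonneg _) hq.le)⟩
  have b1 : ∃ C, ∀ k : Fin r → ℕ,
      ‖∏ i, ∏ j ∈ Finset.Ioi i, (z i * q ^ k i - z j * q ^ k j) / (z i - z j)‖ ≤ C :=
    exists_norm_prod_le _ _ fun i _ => exists_norm_prod_le _ _ fun j _ =>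
      exists_norm_div_const_le (exists_norm_sub_mul_pow_le hq _ (fun _ => z j) (hpow _ _)
        ⟨_, fun _ => le_rfl⟩ _) _
  have b2 : ∃ C, ∀ k : Fin r → ℕ,
      ‖∏ i, (1 - a * z i * q ^ (k i + ∑ l, k l)) / (1 - a * z i)‖ ≤ C :=
    exists_norm_prod_le _ _ fun i _ => exists_norm_div_const_le (hone _ _) _
  have b3 : ∃ C, ∀ k : Fin r → ℕ,
      ‖∏ i, ∏ j, qPoch (e j * z i / z j) q (k i) / qPoch (q * z i / z j) q (k i)‖ ≤ C :=
    exists_norm_prod_le _ _ fun i _ => exists_norm_prod_le _ _ fun j _ => by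
      simp only [div_eq_mul_inv _ (qPoch _ _ _)]
      exact exists_norm_mul_le (hpoch _ _) (hinv _ _ (hqzz i j))
  have b4 : ∃ C, ∀ k : Fin r → ℕ,
      ‖∏ i, qPoch (a * z i) q (∑ l, k l) / qPoch (a * z i * q / e i) q (∑ l, k l)‖ ≤ C :=
    exists_norm_prod_le _ _ fun i _ => by
      simp only [div_eq_mul_inv _ (qPoch _ _ _)]
      exact exists_norm_mul_le (hpoch _ _) (hinv _ _ (haze i))
  have b5 : ∃ C, ∀ k : Fin r → ℕ, ‖∏ i, qPoch (f * z i) q (k i)‖ ≤ C :=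
    exists_norm_prod_le _ _ fun i _ => hpoch _ _
  have b6 : ∃ C, ∀ k : Fin r → ℕ, ‖1 / qPoch (a * q / f) q (∑ l, k l)‖ ≤ C := by
    simp only [one_div]
    exact hinv _ _ haf
  have b7 : ∃ C, ∀ k : Fin r → ℕ,
      ‖(1 - c * q ^ (((∑ l, k l : ℕ) : ℤ) - 1)) / (1 - c / q)‖ ≤ C := by
    have h0 : ∀ k : Fin r → ℕ, c * q ^ (((∑ l, k l : ℕ) : ℤ) - 1) = c / q * q ^ ∑ l, k l :=
      fun k => by
        rw [zpow_sub_one₀ hq0, zpow_natCast]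
        ring
    simp only [h0]
    exact exists_norm_div_const_le (hone _ _) _
  have b8 : ∃ C, ∀ k : Fin r → ℕ,
      ‖∏ i, (1 - a * z i * q ^ (k i + 1) / c) / (1 - a * z i * q / c)‖ ≤ C :=
    exists_norm_prod_le _ _ fun i _ => by
      simp only [mul_div_right_comm _ (q ^ _) c]
      exact exists_norm_div_const_le (hone _ _) _
  obtain ⟨C, hC⟩ := exists_norm_mul_le (exists_norm_mul_le (exists_norm_mul_le (exists_norm_mul_le
    (exists_norm_mul_le (exists_norm_mul_le (exists_norm_mul_le b1 b2) b3) b4) b5) b6) b7) b8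
  refine ⟨C, fun k => ?_⟩
  rw [seriesCoeff, norm_mul, norm_pow]
  exact mul_le_mul_of_nonneg_right (hC k) (by positivity)

/-- The product is majorized by `ρ ^ n ∏ j < n, (1 + ‖q‖ ^ j / ρ)`, whose second factor is a
`q`-shifted factorial with base `‖q‖` and hence bounded. -/
theorem exists_norm_prod_sub_pow_le {q : ℂ} (hq : ‖q‖ < 1) {ρ : ℝ} (hρ : 0 < ρ) :
    ∃ C, ∀ u : ℂ, ‖u‖ ≤ ρ → ∀ n, ‖∏ j ∈ Finset.range n, (u - q ^ j)‖ ≤ C * ρ ^ n := by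
  obtain ⟨C, hC⟩ := exists_norm_qPoch_le (-(ρ : ℂ)⁻¹) (‖q‖ : ℂ) (by simpa using hq)
  refine ⟨C, fun u hu n => ?_⟩
  have h1 : ‖qPoch (-(ρ : ℂ)⁻¹) (‖q‖ : ℂ) n‖ = ∏ j ∈ Finset.range n, (1 + ρ⁻¹ * ‖q‖ ^ j) := by
    rw [qPoch, norm_prod]
    refine Finset.prod_congr rfl fun j _ => ?_
    rw [neg_mul, sub_neg_eq_add]
    have h2 : (1 : ℂ) + (ρ : ℂ)⁻¹ * (‖q‖ : ℂ) ^ j = ((1 + ρ⁻¹ * ‖q‖ ^ j : ℝ) : ℂ) := by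
      push_cast
      rfl
    rw [h2, Complex.norm_real, Real.norm_of_nonneg (by positivity)]
  calc ‖∏ j ∈ Finset.range n, (u - q ^ j)‖ ≤ ∏ j ∈ Finset.range n, ((1 + ρ⁻¹ * ‖q‖ ^ j) * ρ) := by
        rw [norm_prod]
        refine Finset.prod_le_prod (fun _ _ => norm_nonneg _) fun j _ => ?_
        refine (norm_sub_le _ _).trans ?_
        rw [norm_pow, add_mul, one_mul, mul_right_comm, inv_mul_cancel₀ hρ.ne', one_mul]
        exact add_le_add hu le_rfl
    _ = ‖qPoch (-(ρ : ℂ)⁻¹) (‖q‖ : ℂ) n‖ * ρ ^ n := by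
        rw [Finset.prod_mul_distrib, h1, Finset.prod_const, Finset.card_range]
    _ ≤ _ := mul_le_mul_of_nonneg_right (hC n) (by positivity)

/-! ### Analytic continuation in `1 / g` -/

/-- The summand of the series as a function of `u = 1 / g`, multiplied by `∏ i, (a z i q u; q)_∞` to
clear its denominators. Here `(g; q)_{|k|} g^{-|k|}` becomes `∏ j < |k|, (u - q ^ j)`, so that the
function is entire. -/
noncomputable def entireTerm {r : ℕ} (q a c f : ℂ) (e z : Fin r → ℂ) (k : Fin r → ℕ) (u : ℂ) : ℂ :=
  seriesCoeff q a c f e z k * (∏ j ∈ Finset.range (∑ l, k l), (u - q ^ j))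
    * ∏ i, qPochInf (a * z i * q * u * q ^ k i) q

theorem differentiable_entireTerm {r : ℕ} (q a c f : ℂ) (e z : Fin r → ℂ) (hq : ‖q‖ < 1)
    (k : Fin r → ℕ) : Differentiable ℂ (entireTerm q a c f e z k) := by
  unfold entireTerm
  refine ((differentiable_const _).mul ?_).mul ?_
  · exact Differentiable.fun_finsetProd fun j _ => by fun_prop
  · refine Differentiable.fun_finsetProd fun i _ => ?_
    exact (differentiable_qPochInf q hq).comp
      (f := fun u => a * z i * q * u * q ^ k i) (by fun_prop)

theorem exists_norm_entireTerm_le {r : ℕ} (q a c f : ℂ) (e z : Fin r → ℂ) (hq : ‖q‖ < 1)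
    (hq0 : q ≠ 0)
    (hqzz : ∀ i j, ∀ n : ℕ, qPoch (q * z i / z j) q n ≠ 0)
    (haze : ∀ i, ∀ n : ℕ, qPoch (a * z i * q / e i) q n ≠ 0)
    (haf : ∀ n : ℕ, qPoch (a * q / f) q n ≠ 0) {ρ : ℝ} (hρ : 0 < ρ) :
    ∃ C, ∀ (k : Fin r → ℕ) (u : ℂ), ‖u‖ ≤ ρ →
      ‖entireTerm q a c f e z k u‖ ≤ C * (‖a / ((∏ i, e i) * f)‖ * ρ) ^ ∑ l, k l := by
  obtain ⟨C₁, h₁⟩ := exists_norm_seriesCoeff_le q a c f e z hq hq0 hqzz haze haf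
  obtain ⟨C₂, h₂⟩ := exists_norm_prod_sub_pow_le hq hρ
  have h₃ : ∀ i, ∃ C, ∀ (m : ℕ) (u : ℂ), ‖u‖ ≤ ρ →
      ‖qPochInf (a * z i * q * u * q ^ m) q‖ ≤ C := fun i => by
    obtain ⟨C, hC⟩ :=
      (isCompact_closedBall (0 : ℂ) (‖a * z i * q‖ * ρ)).exists_bound_of_continuousOn
        (differentiable_qPochInf q hq).continuous.continuousOn
    refine ⟨C, fun m u hu => hC _ (mem_closedBall_zero_iff.2 ?_)⟩
    rw [norm_mul, norm_pow, norm_mul]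
    exact (mul_le_of_le_one_right (by positivity) (pow_le_one₀ (norm_nonneg _) hq.le)).trans
      (mul_le_mul_of_nonneg_left hu (norm_nonneg _))
  choose C₃ h₃ using h₃
  refine ⟨C₁ * C₂ * ∏ i, C₃ i, fun k u hu => ?_⟩
  rw [entireTerm, norm_mul, norm_mul, norm_prod _ (fun i => qPochInf _ q)]
  calc _ ≤ (C₁ * ‖a / ((∏ i, e i) * f)‖ ^ ∑ l, k l) * (C₂ * ρ ^ ∑ l, k l) * ∏ i, C₃ i := by
        refine mul_le_mul (mul_le_mul (h₁ k) (h₂ u hu _) (norm_nonneg _)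
          ((norm_nonneg _).trans (h₁ k))) (Finset.prod_le_prod (fun _ _ => norm_nonneg _)
          fun i _ => h₃ i _ u hu) (Finset.prod_nonneg fun _ _ => norm_nonneg _) ?_
        exact mul_nonneg ((norm_nonneg _).trans (h₁ k)) ((norm_nonneg _).trans (h₂ u hu _))
    _ = _ := by rw [mul_pow]; ring

open Finset in
/-- At `u = q ^ N` the terms with `|k| > N` vanish and the series is the terminating sum. -/
theorem hasSum_entireTerm_pow {r : ℕ} (q a c f : ℂ) (e z : Fin r → ℂ) (hq : ‖q‖ < 1)
    (h : QGeneric q z)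
    (ha0 : a ≠ 0) (hc0 : c ≠ 0) (hf0 : f ≠ 0) (he0 : ∀ i, e i ≠ 0)
    (haz : ∀ i, 1 - a * z i ≠ 0)
    (haze : ∀ i, ∀ n : ℕ, qPoch (a * z i * q / e i) q n ≠ 0)
    (haf : ∀ n : ℕ, qPoch (a * q / f) q n ≠ 0)
    (hcq : 1 - c / q ≠ 0) (hazc : ∀ i, 1 - a * z i * q / c ≠ 0)
    (hEfa : 1 - (∏ i, e i) * f / a ≠ 0) {N : ℕ} (hN : N ≠ 0)
    (hazN : ∀ i, ∀ n : ℕ, qPoch (a * z i * q ^ (N + 1)) q n ≠ 0) :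
    HasSum (fun k => entireTerm q a c f e z k (q ^ N))
      (boundaryFactor q a c f e z (q ^ N) * (qPoch (a / ((∏ i, e i) * f)) q N
          / qPoch (a * q / f) q N)
        * ∏ i, qPochInf (a * z i * q) q / qPoch (a * z i * q / e i) q N) := by
  have hfin := sum_seriesCoeff q a c f e z h ha0 hc0 hf0 he0 haz haze haf hcq hazc hEfa hN hazN
  have hterm : ∀ k, entireTerm q a c f e z k (q ^ N)
      = (∏ i, qPochInf (a * z i * q ^ (N + 1)) q) * (seriesCoeff q a c f e z k
          * (∏ j ∈ range (∑ l, k l), (q ^ N - q ^ j))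
          / ∏ i, qPoch (a * z i * q ^ (N + 1)) q (k i)) := fun k => by
    have h1 : ∏ i, qPochInf (a * z i * q ^ (N + 1)) q
        = (∏ i, qPoch (a * z i * q ^ (N + 1)) q (k i))
          * ∏ i, qPochInf (a * z i * q * q ^ N * q ^ k i) q := by
      rw [← prod_mul_distrib]
      refine prod_congr rfl fun i _ => ?_
      rw [← qPoch_mul_qPochInf _ q hq (k i)]
      congr 2
      ring
    have h2 : ∏ i, qPoch (a * z i * q ^ (N + 1)) q (k i) ≠ 0 :=
      prod_ne_zero_iff.2 fun i _ => hazN i _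
    rw [h1, entireTerm, mul_comm (∏ i, qPoch (a * z i * q ^ (N + 1)) q (k i)),
      mul_assoc _ (∏ i, qPoch (a * z i * q ^ (N + 1)) q (k i)), mul_div_cancel₀ _ h2, mul_comm]
  have hinj : Set.InjOn (Fin.tail : (Fin (r + 1) → ℕ) → Fin r → ℕ)
      (piAntidiag (univ : Finset (Fin (r + 1))) N) := by
    intro K hK K' hK' hKK
    have h1 := (mem_piAntidiag.1 (mem_coe.1 hK)).1
    have h2 := (mem_piAntidiag.1 (mem_coe.1 hK')).1
    rw [Fin.sum_univ_succ] at h1 h2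
    have h3 : ∀ i : Fin r, K i.succ = K' i.succ := fun i => congrFun hKK i
    simp only [h3] at h1
    funext i
    refine Fin.cases ?_ h3 i
    omega
  have hs := hasSum_sum_of_ne_finset_zero (f := fun k => entireTerm q a c f e z k (q ^ N))
    (s := (piAntidiag (univ : Finset (Fin (r + 1))) N).image Fin.tail) (L := .unconditional _) (by
      intro k hk
      have hlt : N < ∑ l, k l := by
        by_contra hle
        refine hk (mem_image.2 ⟨Fin.cons (N - ∑ l, k l) k, ?_, Fin.tail_cons _ _⟩)
        simp only [mem_piAntidiag, Fin.sum_univ_succ, Fin.cons_zero, Fin.cons_succ, mem_univ,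
          implies_true, and_true]
        omega
      rw [entireTerm, prod_eq_zero (mem_range.2 hlt) (sub_self _)]
      ring)
  rw [sum_image hinj, sum_congr rfl fun K _ => hterm (Fin.tail K), ← mul_sum, hfin] at hs
  convert hs using 1
  rw [mul_left_comm, ← prod_mul_distrib]
  congr 1
  refine prod_congr rfl fun i _ => ?_
  rw [← qPoch_mul_qPochInf (a * z i * q) q hq N, pow_succ']
  ring_nf

/-- If none of the denominators `(q z i / z j; q)_n` vanishes, the variables are generic. -/
theorem QGeneric.of_qPoch_ne_zero {r : ℕ} {q : ℂ} {z : Fin r → ℂ} (hr : 1 ≤ r) (hq0 : q ≠ 0)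
    (hz0 : ∀ i, z i ≠ 0) (hzz : ∀ i j, i < j → z i - z j ≠ 0)
    (hqzz : ∀ i j, ∀ n : ℕ, qPoch (q * z i / z j) q n ≠ 0) : QGeneric q z := by
  have key : ∀ i j, ∀ s : ℕ, z i * q ^ (s + 1) ≠ z j := fun i j s h0 => by
    refine hqzz i j (s + 1) ?_
    have hj := hz0 j
    rw [qPoch_succ, mul_eq_zero]
    right
    rw [← h0] at hj ⊢
    have hi := hz0 i
    field_simp
    ring
  refine ⟨hq0, hz0, fun i j hij s t h0 => ?_,
    fun s h0 => key ⟨0, hr⟩ ⟨0, hr⟩ s (by rw [h0, mul_one])⟩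
  rcases lt_trichotomy s t with hst | hst | hst
  · obtain ⟨d, rfl⟩ := Nat.exists_eq_add_of_lt hst
    refine key j i d (mul_right_cancel₀ (pow_ne_zero s hq0) ?_)
    rw [h0]
    ring
  · subst hst
    have h1 := mul_right_cancel₀ (pow_ne_zero s hq0) h0
    rcases lt_or_gt_of_ne hij with hl | hl
    · exact hzz i j hl (sub_eq_zero.2 h1)
    · exact hzz j i hl (sub_eq_zero.2 h1.symm)
  · obtain ⟨d, rfl⟩ := Nat.exists_eq_add_of_lt hst
    refine key i j d (mul_right_cancel₀ (pow_ne_zero t hq0) ?_)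
    rw [← h0]
    ring

/-- The sum for arbitrary `u₀ = 1 / g` in the disk of convergence `‖a u / E f‖ < 1`. After
multiplication by `(a u / E f; q)_∞` both sides are analytic on a disk about `0`; they agree at
`u = q ^ N` for all large `N`, and these points accumulate at `0`. -/
theorem hasSum_entireTerm {r : ℕ} (q a c f : ℂ) (e z : Fin r → ℂ) (hq : ‖q‖ < 1)
    (h : QGeneric q z)
    (hqzz : ∀ i j, ∀ n : ℕ, qPoch (q * z i / z j) q n ≠ 0)
    (ha0 : a ≠ 0) (hc0 : c ≠ 0) (hf0 : f ≠ 0) (he0 : ∀ i, e i ≠ 0)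
    (haz : ∀ i, 1 - a * z i ≠ 0)
    (haze : ∀ i, ∀ n : ℕ, qPoch (a * z i * q / e i) q n ≠ 0)
    (haf : ∀ n : ℕ, qPoch (a * q / f) q n ≠ 0)
    (hcq : 1 - c / q ≠ 0) (hazc : ∀ i, 1 - a * z i * q / c ≠ 0)
    (hEfa : 1 - (∏ i, e i) * f / a ≠ 0) {u₀ : ℂ} (hu₀ : ‖a / ((∏ i, e i) * f) * u₀‖ < 1) :
    HasSum (fun k => entireTerm q a c f e z k u₀)
      (boundaryFactor q a c f e z u₀ * (qPochInf (a / ((∏ i, e i) * f)) q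
          * qPochInf (a * q / f * u₀) q
          / (qPochInf (a / ((∏ i, e i) * f) * u₀) q * qPochInf (a * q / f) q))
        * ∏ i, qPochInf (a * z i * q) q * qPochInf (a * z i * q / e i * u₀) q
          / qPochInf (a * z i * q / e i) q) := by
  set y := a / ((∏ i, e i) * f) with hy
  have hq0 := h.q_ne_zero
  have hy0 : y ≠ 0 := div_ne_zero ha0
    (mul_ne_zero (Finset.prod_ne_zero_iff.2 fun i _ => he0 i) hf0)
  have hyp : 0 < ‖y‖ := norm_pos_iff.2 hy0
  -- the terms are bounded by a geometric series uniformly for `‖u‖ ≤ ρ`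
  obtain ⟨ρ, hρ₀, hρ₁⟩ : ∃ ρ, ‖u₀‖ < ρ ∧ ρ < ‖y‖⁻¹ := exists_between (by
    rw [norm_mul, mul_comm] at hu₀
    rwa [← one_div, lt_div_iff₀ hyp])
  have hρ : 0 < ρ := (norm_nonneg _).trans_lt hρ₀
  have hyρ : ‖y‖ * ρ < 1 := by
    rwa [← one_div, lt_div_iff₀ hyp, mul_comm] at hρ₁
  obtain ⟨C, hC⟩ := exists_norm_entireTerm_le q a c f e z hq hq0 hqzz haze haf hρ
  have hsum : Summable fun k : Fin r → ℕ => C * (‖y‖ * ρ) ^ ∑ l, k l :=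
    (summable_pow_sum r (by positivity) hyρ).mul_left C
  have hsum₀ : Summable fun k => entireTerm q a c f e z k u₀ :=
    hsum.of_norm_bounded fun k => hC k u₀ hρ₀.le
  have hS : DifferentiableOn ℂ (fun u => ∑' k, entireTerm q a c f e z k u)
      (Metric.ball (0 : ℂ) ρ) :=
    Complex.differentiableOn_tsum_of_summable_norm hsum
      (fun k => (differentiable_entireTerm q a c f e z hq k).differentiableOn) Metric.isOpen_ball
      fun k u hu => hC k u (mem_ball_zero_iff.1 hu).le
  have hP : ∀ w, Differentiable ℂ fun u => qPochInf (w * u) q := fun w =>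
    (differentiable_qPochInf q hq).comp (f := fun u => w * u) (by fun_prop)
  set R : ℂ → ℂ := fun u => boundaryFactor q a c f e z u
    * (qPochInf y q * qPochInf (a * q / f * u) q / qPochInf (a * q / f) q)
    * ∏ i, qPochInf (a * z i * q) q * qPochInf (a * z i * q / e i * u) q
      / qPochInf (a * z i * q / e i) q with hR
  have hRd : Differentiable ℂ R := by
    refine ((?_ : Differentiable ℂ fun u => boundaryFactor q a c f e z u).mul
      (((hP _).const_mul _).div_const _)).mul
      (Differentiable.fun_finsetProd fun i _ => ((hP _).const_mul _).div_const _)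
    simp only [boundaryFactor, div_eq_mul_inv]
    fun_prop
  have hG : AnalyticOnNhd ℂ (fun u => qPochInf (y * u) q * (∑' k, entireTerm q a c f e z k u) - R u)
      (Metric.ball (0 : ℂ) ρ) :=
    (((hP y).differentiableOn.mul hS).sub hRd.differentiableOn).analyticOnNhd Metric.isOpen_ball
  have hqN : Tendsto (fun N : ℕ => q ^ N) atTop (𝓝 0) :=
    tendsto_pow_atTop_nhds_zero_of_norm_lt_one hq
  have hqN' : Tendsto (fun N : ℕ => q ^ N) atTop (𝓝[≠] 0) :=
    tendsto_nhdsWithin_iff.2 ⟨hqN, Eventually.of_forall fun N => pow_ne_zero N hq0⟩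
  have hev : ∀ᶠ N : ℕ in atTop, ∀ i, ‖a * z i * q * q ^ N‖ < 1 :=
    eventually_all.2 fun i => by
      have h1 := (hqN.const_mul (a * z i * q)).norm
      rw [mul_zero, norm_zero] at h1
      exact h1.eventually_lt_const one_pos
  have hzero : ∀ᶠ N : ℕ in atTop,
      qPochInf (y * q ^ N) q * (∑' k, entireTerm q a c f e z k (q ^ N)) - R (q ^ N) = 0 := by
    filter_upwards [hev, eventually_ne_atTop 0] with N hN hN0
    have hazN : ∀ i, ∀ n : ℕ, qPoch (a * z i * q ^ (N + 1)) q n ≠ 0 := fun i n =>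
      Finset.prod_ne_zero_iff.2 fun j _ => one_sub_mul_pow_ne_zero hq (by
        rw [pow_succ', ← mul_assoc]
        exact hN i) j
    rw [(hasSum_entireTerm_pow q a c f e z hq h ha0 hc0 hf0 he0 haz haze haf hcq hazc hEfa hN0
      hazN).tsum_eq, hR, ← hy]
    have h1 := qPoch_mul_qPochInf y q hq N
    have h2 := qPoch_mul_qPochInf (a * q / f) q hq N
    have h3 : ∏ i, qPochInf (a * z i * q) q * qPochInf (a * z i * q / e i * q ^ N) q
        / qPochInf (a * z i * q / e i) q
        = ∏ i, qPochInf (a * z i * q) q / qPoch (a * z i * q / e i) q N :=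
      Finset.prod_congr rfl fun i _ => by
        have h4 := qPochInf_ne_zero_of_qPoch hq (haze i)
        rw [← qPoch_mul_qPochInf (a * z i * q / e i) q hq N] at h4 ⊢
        rw [mul_div_mul_right _ _ (right_ne_zero_of_mul h4)]
    have h5 := qPochInf_ne_zero_of_qPoch hq haf
    rw [← h2] at h5
    have h6 : qPochInf (a * q / f * q ^ N) q / qPochInf (a * q / f) q
        = 1 / qPoch (a * q / f) q N := by
      rw [← h2, div_mul_cancel_right₀ (right_ne_zero_of_mul h5), one_div]
    beta_reduce
    rw [h3, mul_div_assoc _ (qPochInf (a * q / f * q ^ N) q), h6, ← h1]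
    ring
  have hmem : u₀ ∈ Metric.ball (0 : ℂ) ρ := mem_ball_zero_iff.2 hρ₀
  have hzero₀ := hG.eqOn_zero_of_preconnected_of_frequently_eq_zero
    (convex_ball (0 : ℂ) ρ).isPreconnected (Metric.mem_ball_self hρ)
    (hqN'.frequently hzero.frequently) hmem
  have hyu : qPochInf (y * u₀) q ≠ 0 := qPochInf_ne_zero hq (one_sub_mul_pow_ne_zero hq hu₀)
  have hval : ∑' k, entireTerm q a c f e z k u₀ = R u₀ / qPochInf (y * u₀) q := by
    rw [eq_div_iff hyu, mul_comm]
    exact sub_eq_zero.1 hzero₀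
  have hfinal := hsum₀.hasSum
  rw [hval] at hfinal
  convert hfinal using 1
  rw [hR]
  ring

/-! ### The nonterminating sum -/

theorem proposition3p4 (r : ℕ) (hr : 1 ≤ r) (q a c f g : ℂ) (e z : Fin r → ℂ)
    (hq : ‖q‖ < 1) (hw : ‖a / ((∏ i, e i) * f * g)‖ < 1)
    -- none of the denominators vanishes: first the parameters that are divided by
    (hq0 : q ≠ 0) (ha0 : a ≠ 0) (hc0 : c ≠ 0) (hf0 : f ≠ 0) (hg0 : g ≠ 0)
    (he0 : ∀ i, e i ≠ 0) (hz0 : ∀ i, z i ≠ 0)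
    -- then the denominators of the summands
    (hzz : ∀ i j, i < j → z i - z j ≠ 0)
    (haz : ∀ i, 1 - a * z i ≠ 0)
    (hqzz : ∀ i j, ∀ n : ℕ, qPoch (q * z i / z j) q n ≠ 0)
    (haze : ∀ i, ∀ n : ℕ, qPoch (a * z i * q / e i) q n ≠ 0)
    (hazg : ∀ i, ∀ n : ℕ, qPoch (a * z i * q / g) q n ≠ 0)
    (haf : ∀ n : ℕ, qPoch (a * q / f) q n ≠ 0)
    (hcq : 1 - c / q ≠ 0)
    (hazc : ∀ i, 1 - a * z i * q / c ≠ 0)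
    -- and those of the right-hand side that do not follow from the above
    (hcgq : 1 - c / (g * q) ≠ 0)
    (hEfa : 1 - (∏ i, e i) * f / a ≠ 0) :
    HasSum
      (fun k : Fin r → ℕ =>
        (∏ i, ∏ j ∈ Finset.Ioi i, (z i * q ^ k i - z j * q ^ k j) / (z i - z j))
        * (∏ i, (1 - a * z i * q ^ (k i + ∑ l, k l)) / (1 - a * z i))
        * (∏ i, ∏ j, qPoch (e j * z i / z j) q (k i) / qPoch (q * z i / z j) q (k i))
        * (∏ i, qPoch (a * z i) q (∑ l, k l) * qPoch (f * z i) q (k i)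
            / (qPoch (a * z i * q / e i) q (∑ l, k l) * qPoch (a * z i * q / g) q (k i)))
        * (qPoch g q (∑ l, k l) / qPoch (a * q / f) q (∑ l, k l))
        * ((1 - c * q ^ (((∑ l, k l : ℕ) : ℤ) - 1)) / (1 - c / q))
        * (∏ i, (1 - a * z i * q ^ (k i + 1) / c) / (1 - a * z i * q / c))
        * (a / ((∏ i, e i) * f * g)) ^ (∑ l, k l))
      ((1 - (1 - 1 / g) * (1 - c * f / (a * q))
              / ((1 - c / (g * q)) * (1 - (∏ i, e i) * f / a))
            * ∏ i, (1 - c * e i / (a * z i * q)) / (1 - c / (a * z i * q)))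
        * ((1 - c / (g * q)) / (1 - c / q))
        * (qPochInf (a / ((∏ i, e i) * f)) q * qPochInf (a * q / (f * g)) q
            / (qPochInf (a / ((∏ i, e i) * f * g)) q * qPochInf (a * q / f) q))
        * ∏ i, qPochInf (a * z i * q) q * qPochInf (a * z i * q / (e i * g)) q
            / (qPochInf (a * z i * q / e i) q * qPochInf (a * z i * q / g) q)) := by
  have h := QGeneric.of_qPoch_ne_zero hr hq0 hz0 hzz hqzz
  have hE : ∏ i, e i ≠ 0 := Finset.prod_ne_zero_iff.2 fun i _ => he0 i
  have hu : a / ((∏ i, e i) * f) * (1 / g) = a / ((∏ i, e i) * f * g) := by field_simp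
  have hu' : a * q / f * (1 / g) = a * q / (f * g) := by field_simp
  have hD : ∏ i, qPochInf (a * z i * q / g) q ≠ 0 := Finset.prod_ne_zero_iff.2 fun i _ =>
    qPochInf_ne_zero_of_qPoch hq (hazg i)
  have hs := hasSum_entireTerm q a c f e z hq h hqzz ha0 hc0 hf0 he0 haz haze haf hcq hazc hEfa
    (u₀ := 1 / g) (by rwa [hu])
  rw [hu, hu'] at hs
  refine (congrArg₂ (fun F s => HasSum F s) ?_ ?_).mpr
    (hs.div_const (∏ i, qPochInf (a * z i * q / g) q))
  · funext k
    have hpoch : ∏ i, qPochInf (a * z i * q / g) q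
        = (∏ i, qPoch (a * z i * q / g) q (k i))
          * ∏ i, qPochInf (a * z i * q * (1 / g) * q ^ k i) q := by
      rw [← Finset.prod_mul_distrib]
      refine Finset.prod_congr rfl fun i _ => ?_
      rw [← qPoch_mul_qPochInf _ q hq (k i), mul_one_div]
    have hg : qPoch g q (∑ l, k l) = g ^ (∑ l, k l)
        * ∏ j ∈ Finset.range (∑ l, k l), (1 / g - q ^ j) := by
      rw [← Finset.card_range (∑ l, k l), ← Finset.prod_const, Finset.card_range,
        ← Finset.prod_mul_distrib]
      refine Finset.prod_congr rfl fun j _ => ?_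
      field_simp
    have hpow : g ^ (∑ l, k l) * (a / ((∏ i, e i) * f * g)) ^ (∑ l, k l)
        = (a / ((∏ i, e i) * f)) ^ (∑ l, k l) := by
      rw [← mul_pow]
      congr 1
      field_simp
    rw [hpoch] at hD ⊢
    rw [entireTerm, mul_div_mul_right _ _ (right_ne_zero_of_mul hD), seriesCoeff, ← hpow, hg]
    simp only [Finset.prod_div_distrib, Finset.prod_mul_distrib]
    ring
  · have hb : (1 - (1 - 1 / g) * (1 - c * f / (a * q))
          / ((1 - c / (g * q)) * (1 - (∏ i, e i) * f / a))
        * ∏ i, (1 - c * e i / (a * z i * q)) / (1 - c / (a * z i * q)))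
        * ((1 - c / (g * q)) / (1 - c / q)) = boundaryFactor q a c f e z (1 / g) := by
      have h1 : c * (1 / g) / q = c / (g * q) := by field_simp
      rw [boundaryFactor, h1]
      generalize 1 - c / (g * q) = w at hcgq ⊢
      field_simp
    rw [hb, mul_div_assoc _ _ (∏ i, qPochInf (a * z i * q / g) q), ← Finset.prod_div_distrib]
    congr 1
    refine Finset.prod_congr rfl fun i _ => ?_
    have h1 : a * z i * q / (e i * g) = a * z i * q / e i * (1 / g) := by
      have := he0 i
      field_simp
    rw [h1, div_div]
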